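/- **Definitions.** All $C^*$-algebras are unital, $\otimes$ denotes one fixed choice of the injective (minimal) or the projective (maximal) $C^*$-tensor product, $\Sigma$ is the flip on $A\otimes A$, and $A'$ is the dual Banach space of $A$. A *hypergroup structure* $(A,\Delta,\epsilon,\star)$ on a separable unital $C^*$-algebra $A$ with involution $*$ consists of linear maps $\Delta:A\to A\otimes A$, $\epsilon:A\to\mathbb C$ and an antilinear map $\star:A\to A$ such that $(\Delta\otimes \mathrm{id})\Delta=(\mathrm{id}\otimes\Delta)\Delta$ (where $\Delta\otimes\mathrm{id}$ and $\mathrm{id}\otimes\Delta$ extend continuously to $A\otimes A$), $(\epsilon\otimes \mathrm{id})\Delta=(\mathrm{id}\otimes\epsilon)\Delta=\mathrm{id}$, $\Delta\circ\star=\Sigma(\star\otimes\star)\Delta$, $\star\circ\star=\mathrm{id}$; $\Delta$ is positive; and $(ab)^\star=a^\star b^\star$, $\Delta\circ *=(*\otimes *)\Delta$, $\epsilon(ab)=\epsilon(a)\epsilon(b)$, $\Delta(1)=1\otimes1$, $\star\circ *=*\circ\star$. A state $\mu$ is a *Haar measure* if $(\mu\otimes \mathrm{id})\Delta(a)=(\mathrm{id}\otimes\mu)\Delta(a)=\mu(a)1$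 for all $a\in A$. An element $a\in A$ is *positive definite* if $(\xi\otimes\xi^+)\Delta(a)\ge 0$ for all $\xi\in A'$, where $\xi^+(b)=\overline{\xi(b^\star)}$. $\mathcal A=(A,\Delta,\epsilon,\star,\sigma_t,\mu)$ is a *compact quantum hypergroup* if $(A,\Delta,\epsilon,\star)$ is a hypergroup structure with Haar measure $\mu$ and: * (QH1) $\Delta$ is completely positive and the linear span of the positive definite elements is dense in $A$; * (QH2) $\sigma_t$ $(t\in\mathbb R)$ is a continuous one-parameter group of automorphisms of $A$ such that: (a) there are dense unital subalgebras $A_0\subset A$ and $\tilde A_0\subset A\otimes A$ such that $\sigma_t$, respectively $\sigma_t\otimes \mathrm{id}$ and $\mathrm{id}\otimes\sigma_t$, extend to one-parameter groups $\sigma_z$, respectively $\sigma_z\otimes \mathrm{id}$ and $\mathrm{id}\otimes\sigma_z$ $(z\in\mathbb C)$, of automorphisms of the algebra $A_0$, respectively $\tilde A_0$, whose orbits are entire functions of $z$; (b) $A_0$ is invariant under $*$ and $\star$, and $\Delta(A_0)\subset\tilde A_0$; (c) $\Delta\circ\sigma_z=(\sigma_z\otimes\sigma_z)\circ\Delta$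 and $\mu\circ\sigma_z=\mu$ on $A_0$ for all $z\in\mathbb C$, where $\sigma_z\otimes\sigma_z=(\sigma_z\otimes\mathrm{id})(\mathrm{id}\otimes\sigma_z)$; (d) there is $z_0\in\mathbb C$ such that, with $\kappa=*\circ\sigma_{z_0}\circ\star$, for all $a,b\in A_0$ $$(\mathrm{id}\otimes\mu)\bigl[(\kappa\otimes \mathrm{id})\Delta(a)\cdot(1\otimes b)\bigr]=(\mathrm{id}\otimes\mu)\bigl[(1\otimes a)\cdot\Delta(b)\bigr],$$ the left-hand side being understood as $\kappa(s)$ for $s=(\mathrm{id}\otimes\mu)[\Delta(a)(1\otimes b)]$; it is part of the condition that $t\mapsto\sigma_t(s^\star)$ extends to an entire function, whose value at $z_0$ is $\sigma_{z_0}(s^\star)$; * (QH3) $\mu$ is faithful on $A_0$. **Theorem.** Let $\mathcal A=(A,\Delta,\epsilon,\star,\sigma_t,\mu)$ be a compact quantum hypergroup, with $A_0,\tilde A_0,\sigma_z$ as in (QH2). Let $B\subset A$ be a $C^*$-subalgebra containing the unit and let $P:A\to B$ be a conditional expectation (a positive $B$-bimodule map with $P|_B=\mathrm{id}$) such that $\mu\circ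 P=\mu$. Put $\tilde\Delta(x)=(P\otimes P)\Delta(x)\in B\otimes B$ for $x\in B$. Suppose that 1. $(P\otimes P)\Delta(x)=(P\otimes P)\Delta(P(x))$ for all $x\in A$ (that is, $\ker P$ is a coideal); 2. $P\circ\star=\star\circ P$; 3. $A_0$ and $\tilde A_0$ are invariant under $P$ and $P\otimes P$ respectively, and $P\circ\sigma_z=\sigma_z\circ P$ on $A_0$ for all $z\in\mathbb C$; 4. $(\epsilon\otimes \mathrm{id})\tilde\Delta=(\mathrm{id}\otimes\epsilon)\tilde\Delta=\mathrm{id}$ on $B$. Then $\star$ and all $\sigma_t$ restrict to $B$, and $(B,\tilde\Delta,\epsilon|_B,\star|_B,\sigma_t|_B,\mu|_B)$ is a compact quantum hypergroup. -/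

import Mathlib

open scoped TensorProduct ComplexOrder ComplexConjugate

/-! ### The C*-seminorm attached to a set of positive functionals on a `*`-algebra -/

namespace QHyp

section GNS

variable {E : Type*} [Ring E] [StarRing E] [Algebra ℂ E] [StarModule ℂ E]

/-- Positive linear functionals on a complex `*`-algebra. -/
def IsPositiveFunctional (ω : E →ₗ[ℂ] ℂ) : Prop := ∀ y : E, 0 ≤ ω (star y * y)

/-- The norm of the vector represented by `y` in the GNS space of `ω`. -/
noncomputable def gnsVec (ω : E →ₗ[ℂ] ℂ) (y : E) : ℝ := √(ω (star y * y)).re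

/-- `sup ‖π_ω(x)‖` over `ω ∈ S`, where `π_ω` is the GNS representation of `ω`, i.e. the operator
norm of left multiplication by `x` for the GNS inner product `⟪y, y'⟫ = ω (y* y')`. -/
noncomputable def gnsNorm (S : Set (E →ₗ[ℂ] ℂ)) (x : E) : ℝ :=
  sSup {r : ℝ | ∃ ω ∈ S, ∃ y : E, gnsVec ω y ≤ 1 ∧ r = gnsVec ω (x * y)}

theorem IsPositiveFunctional.conj_apply {ω : E →ₗ[ℂ] ℂ} (h : IsPositiveFunctional ω) (x y : E) :
    conj (ω (star y * x)) = ω (star x * y) := by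
  have hx := (Complex.le_def.1 (h x)).2
  have hy := (Complex.le_def.1 (h y)).2
  have h1 := (Complex.le_def.1 (h (x + y))).2
  have h2 := (Complex.le_def.1 (h (x + Complex.I • y))).2
  simp only [star_add, star_smul, add_mul, mul_add, map_add, smul_mul_assoc, mul_smul_comm,
    map_smul, Complex.add_im, smul_eq_mul, Complex.mul_im, Complex.zero_im, Complex.I_re,
    Complex.I_im, RCLike.star_def, Complex.conj_I, Complex.neg_re, Complex.neg_im,
    Complex.mul_re] at hx hy h1 h2
  apply Complex.ext
  · simp only [Complex.conj_re]; linarith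
  · simp only [Complex.conj_im]; linarith

/-- The GNS pre-inner product. -/
@[reducible]
def IsPositiveFunctional.core {ω : E →ₗ[ℂ] ℂ} (h : IsPositiveFunctional ω) :
    PreInnerProductSpace.Core ℂ E where
  inner x y := ω (star x * y)
  conj_inner_symm x y := h.conj_apply x y
  re_inner_nonneg x := (Complex.le_def.1 (h x)).1
  add_left x y z := by simp [add_mul]
  smul_left x y r := by simp

theorem gnsVec_nonneg (ω : E →ₗ[ℂ] ℂ) (y : E) : 0 ≤ gnsVec ω y := Real.sqrt_nonneg _

theorem gnsVec_sq {ω : E →ₗ[ℂ] ℂ} (h : IsPositiveFunctional ω) (y : E) :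
    gnsVec ω y ^ 2 = (ω (star y * y)).re := Real.sq_sqrt (Complex.le_def.1 (h y)).1

theorem gnsVec_add {ω : E →ₗ[ℂ] ℂ} (h : IsPositiveFunctional ω) (x y : E) :
    gnsVec ω (x + y) ≤ gnsVec ω x + gnsVec ω y := by
  letI := h.core
  letI := InnerProductSpace.Core.toSeminormedAddCommGroup (𝕜 := ℂ) (F := E)
  exact norm_add_le x y

theorem gnsVec_smul {ω : E →ₗ[ℂ] ℂ} (h : IsPositiveFunctional ω) (c : ℂ) (x : E) :
    gnsVec ω (c • x) = ‖c‖ * gnsVec ω x := by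
  letI := h.core
  letI := InnerProductSpace.Core.toSeminormedAddCommGroup (𝕜 := ℂ) (F := E)
  letI : NormedSpace ℂ E := InnerProductSpace.Core.toNormedSpace
  exact norm_smul c x

theorem gnsVec_inner_le {ω : E →ₗ[ℂ] ℂ} (h : IsPositiveFunctional ω) (x y : E) :
    ‖ω (star x * y)‖ ≤ gnsVec ω x * gnsVec ω y := by
  letI := h.core
  exact InnerProductSpace.Core.norm_inner_le_norm (𝕜 := ℂ) x y

/-- All elements of the algebra are represented by bounded operators, uniformly in `ω ∈ S`. -/
def IsAdmissible (S : Set (E →ₗ[ℂ] ℂ)) : Prop :=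
  (∀ ω ∈ S, IsPositiveFunctional ω) ∧
    ∀ x : E, ∃ C : ℝ, 0 ≤ C ∧ ∀ ω ∈ S, ∀ y : E, gnsVec ω (x * y) ≤ C * gnsVec ω y

variable {S : Set (E →ₗ[ℂ] ℂ)}

theorem gnsNorm_nonneg (S : Set (E →ₗ[ℂ] ℂ)) (x : E) : 0 ≤ gnsNorm S x := by
  apply Real.sSup_nonneg
  rintro r ⟨ω, -, y, -, rfl⟩
  exact gnsVec_nonneg _ _

theorem IsAdmissible.le_gnsNorm (hS : IsAdmissible S) {ω : E →ₗ[ℂ] ℂ} (hω : ω ∈ S) (x y : E) :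
    gnsVec ω (x * y) ≤ gnsNorm S x * gnsVec ω y := by
  obtain ⟨C, hC, hb⟩ := hS.2 x
  have hpos := hS.1 ω hω
  rcases (gnsVec_nonneg ω y).eq_or_lt with h0 | h0
  · have := hb ω hω y
    rw [← h0] at this ⊢
    simpa using this
  · set c : ℂ := (((gnsVec ω y)⁻¹ : ℝ) : ℂ) with hc
    have hcn : ‖c‖ = (gnsVec ω y)⁻¹ := by
      rw [hc, Complex.norm_real, Real.norm_of_nonneg (inv_nonneg.2 h0.le)]
    have hle : gnsVec ω (x * (c • y)) ≤ gnsNorm S x := by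
      apply le_csSup
      · refine ⟨C, ?_⟩
        rintro r ⟨ω', hω', y', hy', rfl⟩
        exact (hb ω' hω' y').trans (mul_le_of_le_one_right hC hy')
      · exact ⟨ω, hω, c • y, by rw [gnsVec_smul hpos, hcn, inv_mul_cancel₀ h0.ne'], rfl⟩
    rw [mul_smul_comm, gnsVec_smul hpos, hcn] at hle
    rwa [inv_mul_le_iff₀ h0, mul_comm] at hle

theorem gnsNorm_le {x : E} {C : ℝ} (hC : 0 ≤ C)
    (h : ∀ ω ∈ S, ∀ y, gnsVec ω (x * y) ≤ C * gnsVec ω y) : gnsNorm S x ≤ C := by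
  refine Real.sSup_le ?_ hC
  rintro r ⟨ω, hω, y, hy, rfl⟩
  exact (h ω hω y).trans (mul_le_of_le_one_right hC hy)

theorem IsAdmissible.gnsNorm_add (hS : IsAdmissible S) (x x' : E) :
    gnsNorm S (x + x') ≤ gnsNorm S x + gnsNorm S x' := by
  refine gnsNorm_le (add_nonneg (gnsNorm_nonneg _ _) (gnsNorm_nonneg _ _)) fun ω hω y => ?_
  rw [add_mul, add_mul]
  exact (gnsVec_add (hS.1 ω hω) _ _).trans
    (add_le_add (hS.le_gnsNorm hω _ _) (hS.le_gnsNorm hω _ _))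

theorem IsAdmissible.gnsNorm_smul_le (hS : IsAdmissible S) (c : ℂ) (x : E) :
    gnsNorm S (c • x) ≤ ‖c‖ * gnsNorm S x := by
  refine gnsNorm_le (mul_nonneg (norm_nonneg _) (gnsNorm_nonneg _ _)) fun ω hω y => ?_
  rw [smul_mul_assoc, gnsVec_smul (hS.1 ω hω), mul_assoc]
  exact mul_le_mul_of_nonneg_left (hS.le_gnsNorm hω _ _) (norm_nonneg _)

theorem IsAdmissible.gnsNorm_mul (hS : IsAdmissible S) (x x' : E) :
    gnsNorm S (x * x') ≤ gnsNorm S x * gnsNorm S x' := by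
  refine gnsNorm_le (mul_nonneg (gnsNorm_nonneg _ _) (gnsNorm_nonneg _ _)) fun ω hω y => ?_
  rw [mul_assoc, mul_assoc]
  exact (hS.le_gnsNorm hω _ _).trans
    (mul_le_mul_of_nonneg_left (hS.le_gnsNorm hω _ _) (gnsNorm_nonneg _ _))

theorem IsAdmissible.gnsNorm_star_le (hS : IsAdmissible S) (x : E) :
    gnsNorm S (star x) ≤ gnsNorm S x := by
  refine gnsNorm_le (gnsNorm_nonneg _ _) fun ω hω y => ?_
  have hpos := hS.1 ω hω
  have h1 : gnsVec ω (star x * y) ^ 2 ≤ gnsVec ω y * gnsVec ω (x * (star x * y)) := by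
    rw [gnsVec_sq hpos]
    refine (Complex.re_le_norm _).trans ?_
    rw [star_mul, star_star, mul_assoc]
    exact gnsVec_inner_le hpos _ _
  have h2 := hS.le_gnsNorm hω x (star x * y)
  have h3 := gnsVec_nonneg ω y
  have h4 := gnsVec_nonneg ω (star x * y)
  have h5 := gnsNorm_nonneg S x
  rcases h4.eq_or_lt with h0 | h0
  · rw [← h0]; positivity
  · have : gnsVec ω (star x * y) ^ 2 ≤ gnsVec ω y * (gnsNorm S x * gnsVec ω (star x * y)) :=
      h1.trans (mul_le_mul_of_nonneg_left h2 h3)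
    nlinarith

theorem IsAdmissible.gnsNorm_star (hS : IsAdmissible S) (x : E) :
    gnsNorm S (star x) = gnsNorm S x :=
  le_antisymm (hS.gnsNorm_star_le x) (by simpa using hS.gnsNorm_star_le (star x))

theorem IsAdmissible.gnsNorm_mul_self_le (hS : IsAdmissible S) (x : E) :
    gnsNorm S x * gnsNorm S x ≤ gnsNorm S (star x * x) := by
  have hn := gnsNorm_nonneg S (star x * x)
  suffices h : gnsNorm S x ≤ √(gnsNorm S (star x * x)) by
    calc _ ≤ √(gnsNorm S (star x * x)) * √(gnsNorm S (star x * x)) :=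
          mul_self_le_mul_self (gnsNorm_nonneg _ _) h
      _ = _ := Real.mul_self_sqrt hn
  refine gnsNorm_le (Real.sqrt_nonneg _) fun ω hω y => ?_
  have hpos := hS.1 ω hω
  have h3 := gnsVec_nonneg ω y
  have h1 : gnsVec ω (x * y) ^ 2 ≤ gnsVec ω y * gnsVec ω (star x * x * y) := by
    rw [gnsVec_sq hpos]
    refine (Complex.re_le_norm _).trans ?_
    rw [star_mul, mul_assoc, ← mul_assoc (star x)]
    exact gnsVec_inner_le hpos _ _
  have h2 := hS.le_gnsNorm hω (star x * x) y
  refine le_of_sq_le_sq ?_ (by positivity)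
  rw [mul_pow, Real.sq_sqrt hn]
  nlinarith

theorem IsAdmissible.gnsNorm_zero (hS : IsAdmissible S) : gnsNorm S (0 : E) = 0 :=
  le_antisymm (by simpa using hS.gnsNorm_smul_le 0 0) (gnsNorm_nonneg _ _)

theorem IsAdmissible.gnsNorm_neg (hS : IsAdmissible S) (x : E) : gnsNorm S (-x) = gnsNorm S x := by
  have h : ∀ z : E, gnsNorm S (-z) ≤ gnsNorm S z := fun z => by
    simpa using hS.gnsNorm_smul_le (-1) z
  exact le_antisymm (h x) (by simpa using h (-x))

/-- The seminormed algebra structure defined by `gnsNorm S`. -/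
@[reducible]
noncomputable def IsAdmissible.seminormedRing (hS : IsAdmissible S) : SeminormedRing E where
  __ := (inferInstance : Ring E)
  __ := AddGroupSeminorm.toSeminormedAddCommGroup
    { toFun := gnsNorm S
      map_zero' := hS.gnsNorm_zero
      add_le' := hS.gnsNorm_add
      neg' := hS.gnsNorm_neg }
  norm_mul_le := hS.gnsNorm_mul

end GNS

/-! ### C*-tensor products -/

section Tensor

universe u v

/-- The two C*-tensor products: the injective (minimal) and the projective (maximal) one. -/
inductive CStarTensorKind
  | injective
  | projective

variable {A : Type u} [CStarAlgebra A] {B : Type v} [CStarAlgebra B]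

/-- States of a unital C*-algebra. -/
structure IsState (φ : A →L[ℂ] ℂ) : Prop where
  nonneg : ∀ a, 0 ≤ φ (star a * a)
  map_one : φ 1 = 1

/-- The functional `φ ⊗ ψ` on the algebraic tensor product. -/
noncomputable def algProd (φ : A →L[ℂ] ℂ) (ψ : B →L[ℂ] ℂ) : A ⊗[ℂ] B →ₗ[ℂ] ℂ :=
  LinearMap.mul' ℂ ℂ ∘ₗ TensorProduct.map (φ : A →ₗ[ℂ] ℂ) (ψ : B →ₗ[ℂ] ℂ)

/-- The functionals whose GNS representations define the norm: the products of states for the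
injective tensor product (`π_{φ ⊗ ψ} = π_φ ⊗ π_ψ`, so this is the spatial norm), all positive
functionals on the algebraic tensor product for the projective one. -/
def testFunctionals (k : CStarTensorKind) (A : Type u) [CStarAlgebra A] (B : Type v)
    [CStarAlgebra B] : Set (A ⊗[ℂ] B →ₗ[ℂ] ℂ) :=
  match k with
  | .injective => {ω | ∃ (φ : A →L[ℂ] ℂ) (ψ : B →L[ℂ] ℂ), IsState φ ∧ IsState ψ ∧ ω = algProd φ ψ}
  | .projective => {ω | IsPositiveFunctional ω}

theorem posSemidef_gram {E : Type*} [Ring E] [StarRing E] [Algebra ℂ E] [StarModule ℂ E]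
    {ω : E →ₗ[ℂ] ℂ} (h : IsPositiveFunctional ω) {ι : Type*} [Fintype ι] (a : ι → E) :
    (Matrix.of fun i j => ω (star (a i) * a j)).PosSemidef := by
  rw [Matrix.posSemidef_iff_dotProduct_mulVec]
  constructor
  · ext i j
    simpa using h.conj_apply (a i) (a j)
  · intro x
    have := h (∑ i, x i • a i)
    simp only [star_sum, star_smul, Finset.sum_mul, Finset.mul_sum, map_sum, smul_mul_assoc,
      mul_smul_comm, map_smul, smul_eq_mul] at this
    simp only [dotProduct, Matrix.mulVec, Finset.mul_sum, Matrix.of_apply, Pi.star_apply]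
    rw [Finset.sum_comm] at this
    refine this.trans_eq (Finset.sum_congr rfl fun i _ => Finset.sum_congr rfl fun j _ => ?_)
    ring

theorem isPositiveFunctional_algProd {φ : A →L[ℂ] ℂ} {ψ : B →L[ℂ] ℂ} (hφ : IsState φ)
    (hψ : IsState ψ) : IsPositiveFunctional (algProd φ ψ) := by
  intro w
  obtain ⟨s, rfl⟩ := TensorProduct.exists_finset w
  have h1 := posSemidef_gram (ω := (φ : A →ₗ[ℂ] ℂ)) hφ.nonneg (fun i : s => i.1.1)
  have h2 := posSemidef_gram (ω := (ψ : B →ₗ[ℂ] ℂ)) hψ.nonneg (fun i : s => i.1.2)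
  have h3 := (h1.hadamard h2).dotProduct_mulVec_nonneg (fun _ => 1)
  simp only [dotProduct, Matrix.mulVec, Matrix.hadamard_apply, Matrix.of_apply, Pi.star_apply,
    star_one, one_mul, mul_one] at h3
  rw [← Finset.sum_coe_sort s, star_sum, Finset.sum_mul, map_sum]
  refine h3.trans_eq (Finset.sum_congr rfl fun i _ => ?_)
  rw [Finset.mul_sum, map_sum]
  exact Finset.sum_congr rfl fun j _ => by simp [algProd]

theorem gnsVec_mul_le_of_defect {E : Type*} [Ring E] [StarRing E] [Algebra ℂ E] [StarModule ℂ E]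
    {ω : E →ₗ[ℂ] ℂ} (h : IsPositiveFunctional ω) {x c : E} {r : ℝ} (hr : 0 ≤ r)
    (hc : star x * x + star c * c = ((r ^ 2 : ℝ) : ℂ) • (1 : E)) (y : E) :
    gnsVec ω (x * y) ≤ r * gnsVec ω y := by
  refine le_of_sq_le_sq ?_ (mul_nonneg hr (gnsVec_nonneg _ _))
  have h1 : star (x * y) * (x * y) + star (c * y) * (c * y)
      = ((r ^ 2 : ℝ) : ℂ) • (star y * y) := by
    have : star (x * y) * (x * y) + star (c * y) * (c * y)
        = star y * (star x * x + star c * c) * y := by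
      simp only [star_mul]; noncomm_ring
    rw [this, hc]; simp
  have h2 := congrArg (fun z => (ω z).re) h1
  simp only [map_add, Complex.add_re, map_smul, smul_eq_mul, Complex.re_ofReal_mul] at h2
  rw [mul_pow, gnsVec_sq h, gnsVec_sq h, ← h2]
  linarith [(Complex.le_def.1 (h (c * y))).1, Complex.zero_re]

theorem exists_defect (a : A) :
    ∃ c : A, star a * a + star c * c = ((‖a‖ ^ 2 : ℝ) : ℂ) • (1 : A) := by
  letI := CStarAlgebra.spectralOrder A
  letI := CStarAlgebra.spectralOrderedRing A
  have h := CStarAlgebra.star_mul_le_algebraMap_norm_sq (a := a)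
  rw [← sub_nonneg, CStarAlgebra.nonneg_iff_eq_star_mul_self] at h
  obtain ⟨c, hc⟩ := h
  refine ⟨c, ?_⟩
  rw [← hc, Algebra.algebraMap_eq_smul_one, Complex.coe_smul]
  abel

theorem gnsVec_tmul_mul_le {ω : A ⊗[ℂ] B →ₗ[ℂ] ℂ} (h : IsPositiveFunctional ω) (a : A) (b : B)
    (y : A ⊗[ℂ] B) : gnsVec ω ((a ⊗ₜ[ℂ] b) * y) ≤ ‖a‖ * ‖b‖ * gnsVec ω y := by
  obtain ⟨c, hc⟩ := exists_defect a
  obtain ⟨d, hd⟩ := exists_defect b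
  have e : (a ⊗ₜ[ℂ] b) * y = (a ⊗ₜ[ℂ] (1 : B)) * (((1 : A) ⊗ₜ[ℂ] b) * y) := by
    rw [← mul_assoc]; simp
  rw [e, mul_assoc]
  refine (gnsVec_mul_le_of_defect h (c := c ⊗ₜ[ℂ] (1 : B)) (norm_nonneg a) ?_ _).trans
    (mul_le_mul_of_nonneg_left
      (gnsVec_mul_le_of_defect h (c := (1 : A) ⊗ₜ[ℂ] d) (norm_nonneg b) ?_ _) (norm_nonneg a))
  · simp only [TensorProduct.star_tmul, star_one, Algebra.TensorProduct.tmul_mul_tmul, mul_one,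
      ← TensorProduct.add_tmul, hc, ← TensorProduct.smul_tmul', Algebra.TensorProduct.one_def]
  · simp only [TensorProduct.star_tmul, star_one, Algebra.TensorProduct.tmul_mul_tmul, mul_one,
      ← TensorProduct.tmul_add, hd, TensorProduct.tmul_smul, Algebra.TensorProduct.one_def]

theorem isAdmissible_testFunctionals (k : CStarTensorKind) :
    IsAdmissible (testFunctionals k A B) := by
  have hpos : ∀ ω ∈ testFunctionals k A B, IsPositiveFunctional ω := by
    cases k with
    | injective => rintro ω ⟨φ, ψ, hφ, hψ, rfl⟩; exact isPositiveFunctional_algProd hφ hψ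
    | projective => exact fun ω hω => hω
  refine ⟨hpos, fun x => ?_⟩
  induction x using TensorProduct.induction_on with
  | zero =>
    refine ⟨0, le_rfl, fun ω _ y => ?_⟩
    simp [gnsVec]
  | tmul a b =>
    exact ⟨‖a‖ * ‖b‖, by positivity, fun ω hω y => gnsVec_tmul_mul_le (hpos ω hω) a b y⟩
  | add x x' hx hx' =>
    obtain ⟨C, hC, h⟩ := hx
    obtain ⟨C', hC', h'⟩ := hx'
    refine ⟨C + C', add_nonneg hC hC', fun ω hω y => ?_⟩
    rw [add_mul, add_mul]
    exact (gnsVec_add (hpos ω hω) _ _).trans (add_le_add (h ω hω y) (h' ω hω y))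

/-- The algebraic tensor product, equipped below with the C*-seminorm of the given kind. -/
def AlgTensor (_k : CStarTensorKind) (A : Type u) [CStarAlgebra A] (B : Type v) [CStarAlgebra B] :
    Type (max u v) := A ⊗[ℂ] B

variable (k : CStarTensorKind)

noncomputable instance : Ring (AlgTensor k A B) := inferInstanceAs (Ring (A ⊗[ℂ] B))
noncomputable instance : StarRing (AlgTensor k A B) := inferInstanceAs (StarRing (A ⊗[ℂ] B))
noncomputable instance : Algebra ℂ (AlgTensor k A B) := inferInstanceAs (Algebra ℂ (A ⊗[ℂ] B))
instance : StarModule ℂ (AlgTensor k A B) := inferInstanceAs (StarModule ℂ (A ⊗[ℂ] B))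

noncomputable instance : SeminormedRing (AlgTensor k A B) :=
  IsAdmissible.seminormedRing (E := AlgTensor k A B) (S := testFunctionals k A B)
    (isAdmissible_testFunctionals k)

theorem AlgTensor.norm_def (x : AlgTensor k A B) :
    ‖x‖ = gnsNorm (E := A ⊗[ℂ] B) (testFunctionals k A B) x := rfl

noncomputable instance : NormedAlgebra ℂ (AlgTensor k A B) where
  __ := (inferInstance : Algebra ℂ (AlgTensor k A B))
  norm_smul_le := (isAdmissible_testFunctionals k).gnsNorm_smul_le

instance : NormedStarGroup (AlgTensor k A B) where
  norm_star_le := (isAdmissible_testFunctionals k).gnsNorm_star_le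

open UniformSpace

/-- The C*-tensor product of the given kind: the completion of the algebraic tensor product. -/
def CStarTensor (k : CStarTensorKind) (A : Type u) [CStarAlgebra A] (B : Type v) [CStarAlgebra B] :
    Type (max u v) := Completion (AlgTensor k A B)

noncomputable instance : NormedRing (CStarTensor k A B) :=
  inferInstanceAs (NormedRing (Completion (AlgTensor k A B)))

instance : CompleteSpace (CStarTensor k A B) :=
  inferInstanceAs (CompleteSpace (Completion (AlgTensor k A B)))

noncomputable instance : Algebra ℂ (CStarTensor k A B) :=
  inferInstanceAs (Algebra ℂ (Completion (AlgTensor k A B)))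

noncomputable instance : NormedAlgebra ℂ (CStarTensor k A B) where
  norm_smul_le := norm_smul_le (α := ℂ) (β := Completion (AlgTensor k A B))

noncomputable instance : Star (CStarTensor k A B) where
  star := Completion.map (star : AlgTensor k A B → AlgTensor k A B)

/-- The canonical map of the algebraic tensor product to its completion. -/
noncomputable def AlgTensor.toCStar (x : AlgTensor k A B) : CStarTensor k A B :=
  (x : Completion (AlgTensor k A B))

variable {k}

theorem toCStar_star (x : AlgTensor k A B) : star (x.toCStar k) = (star x).toCStar k :=
  Completion.map_coe (NormedAddGroupHom.uniformContinuous
    (V₁ := AlgTensor k A B) (V₂ := AlgTensor k A B) (starNormedAddGroupHom)) x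

theorem CStarTensor.continuous_star :
    Continuous (star : CStarTensor k A B → CStarTensor k A B) :=
  Completion.continuous_map

theorem CStarTensor.induction {p : CStarTensor k A B → Prop} (x : CStarTensor k A B)
    (hp : IsClosed {x | p x}) (h : ∀ x : AlgTensor k A B, p (x.toCStar k)) : p x :=
  Completion.induction_on x hp h

theorem toCStar_mul (x y : AlgTensor k A B) :
    (x * y).toCStar k = x.toCStar k * y.toCStar k := Completion.coe_mul x y

theorem toCStar_add (x y : AlgTensor k A B) :
    (x + y).toCStar k = x.toCStar k + y.toCStar k := Completion.coe_add x y

theorem toCStar_smul (c : ℂ) (x : AlgTensor k A B) :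
    (c • x).toCStar k = c • x.toCStar k := Completion.coe_smul c x

theorem norm_toCStar (x : AlgTensor k A B) : ‖x.toCStar k‖ = ‖x‖ := Completion.norm_coe x

noncomputable instance : StarRing (CStarTensor k A B) where
  star_involutive x := by
    refine CStarTensor.induction (p := fun x => star (star x) = x) x
      (isClosed_eq (CStarTensor.continuous_star.comp CStarTensor.continuous_star) continuous_id)
      fun x => ?_
    rw [toCStar_star, toCStar_star, star_star]
  star_mul x y := by
    refine CStarTensor.induction (p := fun x => star (x * y) = star y * star x) x
      (isClosed_eq (CStarTensor.continuous_star.comp (continuous_id.mul continuous_const))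
        (continuous_const.mul CStarTensor.continuous_star)) fun x => ?_
    refine CStarTensor.induction (p := fun y => star (x.toCStar k * y) = star y * star (x.toCStar k))
      y (isClosed_eq (CStarTensor.continuous_star.comp (continuous_const.mul continuous_id))
        (CStarTensor.continuous_star.mul continuous_const)) fun y => ?_
    rw [← toCStar_mul, toCStar_star, toCStar_star, toCStar_star, star_mul, toCStar_mul]
  star_add x y := by
    refine CStarTensor.induction (p := fun x => star (x + y) = star x + star y) x
      (isClosed_eq (CStarTensor.continuous_star.comp (continuous_id.add continuous_const))
        (CStarTensor.continuous_star.add continuous_const)) fun x => ?_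
    refine CStarTensor.induction (p := fun y => star (x.toCStar k + y) = star (x.toCStar k) + star y)
      y (isClosed_eq (CStarTensor.continuous_star.comp (continuous_const.add continuous_id))
        (continuous_const.add CStarTensor.continuous_star)) fun y => ?_
    rw [← toCStar_add, toCStar_star, toCStar_star, toCStar_star, star_add, toCStar_add]

noncomputable instance : CStarAlgebra (CStarTensor k A B) where
  norm_mul_self_le x := by
    refine CStarTensor.induction (p := fun x => ‖x‖ * ‖x‖ ≤ ‖star x * x‖) x
      (isClosed_le (continuous_norm.mul continuous_norm)
        (continuous_norm.comp (CStarTensor.continuous_star.mul continuous_id))) fun x => ?_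
    rw [toCStar_star, ← toCStar_mul, norm_toCStar, norm_toCStar]
    exact (isAdmissible_testFunctionals k).gnsNorm_mul_self_le x
  star_smul c x := by
    refine CStarTensor.induction (p := fun x => star (c • x) = star c • star x) x
      (isClosed_eq (CStarTensor.continuous_star.comp (continuous_const_smul c))
        (CStarTensor.continuous_star.const_smul (star c))) fun x => ?_
    rw [← toCStar_smul, toCStar_star, toCStar_star, star_smul, toCStar_smul]

variable (k)

/-- The elementary tensor `a ⊗ b` in the C*-tensor product. -/
noncomputable def tmul (a : A) (b : B) : CStarTensor k A B :=
  AlgTensor.toCStar k (a ⊗ₜ[ℂ] b : A ⊗[ℂ] B)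

variable {k}

/-- `F` is the continuous extension of the assignment `a ⊗ b ↦ G a b` to the C*-tensor product.
`F` is only required to be additive, so that antilinear maps such as `⋆ ⊗ ⋆` are covered; there is
at most one such `F`. -/
structure IsTensorExtension {E : Type*} [TopologicalSpace E] [Add E] (G : A → B → E)
    (F : CStarTensor k A B → E) : Prop where
  continuous : Continuous F
  map_add : ∀ x y, F (x + y) = F x + F y
  map_tmul : ∀ a b, F (tmul k a b) = G a b

open scoped Classical in
/-- The continuous extension of `a ⊗ b ↦ G a b` to the C*-tensor product
(by convention `0` if there is none). -/
noncomputable def tlift {E : Type*} [TopologicalSpace E] [Add E] [Zero E] (G : A → B → E) :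
    CStarTensor k A B → E :=
  if h : ∃ F : CStarTensor k A B → E, IsTensorExtension G F then h.choose else 0

theorem IsTensorExtension.unique {E : Type*} [TopologicalSpace E] [AddCommGroup E] [T2Space E]
    {G : A → B → E} {F F' : CStarTensor k A B → E} (hF : IsTensorExtension G F)
    (hF' : IsTensorExtension G F') : F = F' := by
  funext x
  refine CStarTensor.induction (p := fun x => F x = F' x) x
    (isClosed_eq hF.continuous hF'.continuous) fun x => ?_
  have h0 : F 0 = F' 0 := by
    have h1 := hF.map_add 0 0
    have h2 := hF'.map_add 0 0
    rw [add_zero] at h1 h2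
    rw [left_eq_add.1 h1, left_eq_add.1 h2]
  have key : ∀ x : A ⊗[ℂ] B, F (AlgTensor.toCStar k x) = F' (AlgTensor.toCStar k x) := by
    intro x
    induction x using TensorProduct.induction_on with
    | zero =>
      have : AlgTensor.toCStar k (0 : AlgTensor k A B) = 0 := Completion.coe_zero
      exact (congrArg F this).trans (h0.trans (congrArg F' this).symm)
    | tmul a b => exact (hF.map_tmul a b).trans (hF'.map_tmul a b).symm
    | add x y hx hy =>
      have := toCStar_add (k := k) (A := A) (B := B) x y
      exact (congrArg F this).trans ((hF.map_add _ _).trans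
        ((congrArg₂ (· + ·) hx hy).trans
          ((hF'.map_add _ _).symm.trans (congrArg F' this).symm)))
  exact key x

theorem IsTensorExtension.tlift_eq {E : Type*} [TopologicalSpace E] [AddCommGroup E] [T2Space E]
    {G : A → B → E} {F : CStarTensor k A B → E} (hF : IsTensorExtension G F) : tlift G = F := by
  have h : ∃ F : CStarTensor k A B → E, IsTensorExtension G F := ⟨F, hF⟩
  rw [tlift, dif_pos h]
  exact h.choose_spec.unique hF

/-- The flip `a ⊗ b ↦ b ⊗ a`. -/
noncomputable def tensorFlip : CStarTensor k A B → CStarTensor k B A :=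
  tlift fun a b => tmul k b a

/-- The canonical identification `(a ⊗ b) ⊗ c ↦ a ⊗ (b ⊗ c)`. -/
noncomputable def tensorAssoc {C : Type*} [CStarAlgebra C] :
    CStarTensor k (CStarTensor k A B) C → CStarTensor k A (CStarTensor k B C) :=
  tlift fun x c => tlift (fun a b => tmul k a (tmul k b c)) x

end Tensor

/-! ### Positive maps and conditional expectations -/

section Maps

variable {A C : Type*} [CStarAlgebra A] [CStarAlgebra C]

/-- Positive maps of C*-algebras (for the usual C*-algebra order). -/
def IsPositiveMap (φ : A →ₗ[ℂ] C) : Prop :=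
  letI := CStarAlgebra.spectralOrder A
  letI := CStarAlgebra.spectralOrder C
  ∀ a : A, 0 ≤ a → 0 ≤ φ a

/-- Completely positive maps of C*-algebras (for the usual C*-algebra order). -/
def IsCompletelyPositive (φ : A →ₗ[ℂ] C) : Prop :=
  letI := CStarAlgebra.spectralOrder A
  letI := CStarAlgebra.spectralOrder C
  haveI := CStarAlgebra.spectralOrderedRing A
  haveI := CStarAlgebra.spectralOrderedRing C
  ∃ Φ : CompletelyPositiveMap A C, Φ.toLinearMap = φ

/-- Conditional expectations of a unital C*-algebra onto a unital C*-subalgebra: positive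
`B`-bimodule projections. -/
structure IsConditionalExpectation {B : StarSubalgebra ℂ A} [IsClosed (B : Set A)]
    (P : A →ₗ[ℂ] B) : Prop where
  positive : IsPositiveMap P
  apply_coe : ∀ b : B, P (b : A) = b
  bimodule : ∀ (b b' : B) (a : A), P ((b : A) * a * (b' : A)) = b * P a * b'

end Maps

/-! ### Quantum hypergroups -/

section Hypergroups

variable {A : Type*} [CStarAlgebra A] {k : CStarTensorKind}

/-- `(A, Δ, ε, ⋆)` is a hypergroup structure on the C*-algebra `A`; the map `⋆` is `inv`, and the
C*-involution `*` of `A` and of `A ⊗ A` is `star`. -/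
structure IsHypergroupStructure (Δ : A →ₗ[ℂ] CStarTensor k A A) (ε : A →ₗ[ℂ] ℂ)
    (inv : A →ₗ⋆[ℂ] A) : Prop where
  separable : TopologicalSpace.SeparableSpace A
  /-- `Δ ⊗ id` makes sense on `A ⊗ A`. -/
  comul_id : ∃ F : CStarTensor k A A → CStarTensor k (CStarTensor k A A) A,
    IsTensorExtension (fun a b => tmul k (Δ a) b) F
  /-- `id ⊗ Δ` makes sense on `A ⊗ A`. -/
  id_comul : ∃ F : CStarTensor k A A → CStarTensor k A (CStarTensor k A A),
    IsTensorExtension (fun a b => tmul k a (Δ b)) F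
  /-- `(Δ ⊗ id) ∘ Δ = (id ⊗ Δ) ∘ Δ` -/
  coassoc : ∀ a, tensorAssoc (tlift (fun x y => tmul k (Δ x) y) (Δ a)) =
    tlift (fun x y => tmul k x (Δ y)) (Δ a)
  /-- `(ε ⊗ id) ∘ Δ = id` -/
  counit_left : ∀ a, tlift (fun x y => ε x • y) (Δ a) = a
  /-- `(id ⊗ ε) ∘ Δ = id` -/
  counit_right : ∀ a, tlift (fun x y => ε y • x) (Δ a) = a
  /-- `Δ ∘ ⋆ = Σ ∘ (⋆ ⊗ ⋆) ∘ Δ` -/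
  comul_inv : ∀ a, Δ (inv a) =
    tensorFlip (tlift (fun x y => tmul k (inv x) (inv y)) (Δ a) : CStarTensor k A A)
  inv_inv : ∀ a, inv (inv a) = a
  comul_positive : IsPositiveMap Δ
  inv_mul : ∀ a b, inv (a * b) = inv a * inv b
  comul_star : ∀ a, Δ (star a) = star (Δ a)
  counit_mul : ∀ a b, ε (a * b) = ε a * ε b
  comul_one : Δ 1 = tmul k 1 1
  inv_star : ∀ a, inv (star a) = star (inv a)

/-- `μ` is a Haar measure: a state with `(μ ⊗ id) ∘ Δ = (id ⊗ μ) ∘ Δ = μ(·) 1`. -/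
structure IsHaarMeasure (Δ : A →ₗ[ℂ] CStarTensor k A A) (μ : A →L[ℂ] ℂ) : Prop where
  isState : IsState μ
  left_inv : ∀ a, tlift (fun x y => μ x • y) (Δ a) = μ a • (1 : A)
  right_inv : ∀ a, tlift (fun x y => μ y • x) (Δ a) = μ a • (1 : A)

/-- `a` is positive definite: `(ξ · ξ⁺)(a) = (ξ ⊗ ξ⁺)(Δ a) ≥ 0` for all `ξ ∈ A'`, where
`ξ⁺(b)` is the complex conjugate of `ξ(b^⋆)`. -/
def IsPositiveDefinite (Δ : A →ₗ[ℂ] CStarTensor k A A) (inv : A →ₗ⋆[ℂ] A) (a : A) : Prop :=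
  ∀ ξ : A →L[ℂ] ℂ, 0 ≤ tlift (fun x y => ξ x * conj (ξ (inv y))) (Δ a)

/-- The one-parameter family `τ` of maps of the Banach algebra `X` extends to the complex
one-parameter group `τc` of automorphisms of the subalgebra `D`: on `D`, `τc t = τ t` for real `t`,
and all orbits of `τc` are entire functions. -/
structure IsComplexExtension {X : Type*} [NormedRing X] [NormedAlgebra ℂ X] (τ : ℝ → X → X)
    (D : Subalgebra ℂ X) (τc : ℂ → D ≃ₐ[ℂ] D) : Prop where
  map_add : ∀ z w x, τc (z + w) x = τc z (τc w x)
  map_real : ∀ (t : ℝ) (x : D), (τc t x : X) = τ t x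
  entire : ∀ x : D, Differentiable ℂ fun z => (τc z x : X)

/-- `(A, Δ, ε, ⋆, σ_t, μ)` is a compact quantum hypergroup, with the dense subalgebras
`A₀ ⊆ A`, `A₂ ⊆ A ⊗ A` and the complex one-parameter group `σc` on `A₀` as in its definition. -/
structure IsCompactQuantumHypergroupOn (Δ : A →ₗ[ℂ] CStarTensor k A A) (ε : A →ₗ[ℂ] ℂ)
    (inv : A →ₗ⋆[ℂ] A) (σ : ℝ → A ≃⋆ₐ[ℂ] A) (μ : A →L[ℂ] ℂ)
    (A₀ : Subalgebra ℂ A) (A₂ : Subalgebra ℂ (CStarTensor k A A)) (σc : ℂ → A₀ ≃ₐ[ℂ] A₀) :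
    Prop where
  hypergroup : IsHypergroupStructure Δ ε inv
  haar : IsHaarMeasure Δ μ
  completelyPositive : IsCompletelyPositive Δ
  dense_positiveDefinite :
    Dense (Submodule.span ℂ {a : A | IsPositiveDefinite Δ inv a} : Set A)
  /-- `σ` is a continuous one-parameter group of automorphisms of `A`. -/
  σ_add : ∀ s t a, σ (s + t) a = σ s (σ t a)
  σ_continuous : ∀ a, Continuous fun t => σ t a
  dense_A₀ : Dense (A₀ : Set A)
  dense_A₂ : Dense (A₂ : Set (CStarTensor k A A))
  extends_σ : IsComplexExtension (fun t => σ t) A₀ σc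
  star_mem : ∀ a ∈ A₀, star a ∈ A₀
  inv_mem : ∀ a ∈ A₀, inv a ∈ A₀
  comul_mem : ∀ a ∈ A₀, Δ a ∈ A₂
  /-- `σ_t ⊗ id` and `id ⊗ σ_t` extend to complex one-parameter groups `σ_z ⊗ id`, `id ⊗ σ_z` on
  `A₂`, and `Δ ∘ σ_z = (σ_z ⊗ σ_z) ∘ Δ` on `A₀`, where `σ_z ⊗ σ_z = (σ_z ⊗ id) ∘ (id ⊗ σ_z)`. -/
  extends_σ₂ : ∃ σl σr : ℂ → A₂ ≃ₐ[ℂ] A₂,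
    IsComplexExtension (fun t => tlift fun x y => tmul k (σ t x) y) A₂ σl ∧
    IsComplexExtension (fun t => tlift fun x y => tmul k x (σ t y)) A₂ σr ∧
    ∀ (z : ℂ) (a : A₀),
      Δ (σc z a : A) = (σl z (σr z ⟨Δ (a : A), comul_mem a a.2⟩) : CStarTensor k A A)
  haar_σ : ∀ (z : ℂ) (a : A₀), μ (σc z a : A) = μ a
  /-- Strong invariance `(id ⊗ μ)[(κ ⊗ id)Δ(a) · (1 ⊗ b)] = (id ⊗ μ)[(1 ⊗ a) · Δ(b)]` for
  the antipode `κ = * ∘ σ_{z₀} ∘ ⋆`. As `κ` acts on the first leg only, the left-hand side is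
  `κ (s)` for the slice `s = (id ⊗ μ)[Δ(a) · (1 ⊗ b)]`; here `σ_{z₀} (s^⋆)` is the value at `z₀`
  of the entire extension `f` of `t ↦ σ_t (s^⋆)`. -/
  strong_invariance : ∃ z₀ : ℂ, ∀ a ∈ A₀, ∀ b ∈ A₀, ∃ f : ℂ → A, Differentiable ℂ f ∧
    (∀ t : ℝ, f t = σ t (inv (tlift (fun x y => μ y • x) (Δ a * tmul k 1 b)))) ∧
    star (f z₀) = tlift (fun x y => μ y • x) (tmul k 1 a * Δ b)
  faithful : ∀ a ∈ A₀, μ (star a * a) = 0 → a = 0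

/-- `(A, Δ, ε, ⋆, σ_t, μ)` is a compact quantum hypergroup. -/
def IsCompactQuantumHypergroup (Δ : A →ₗ[ℂ] CStarTensor k A A) (ε : A →ₗ[ℂ] ℂ)
    (inv : A →ₗ⋆[ℂ] A) (σ : ℝ → A ≃⋆ₐ[ℂ] A) (μ : A →L[ℂ] ℂ) : Prop :=
  ∃ (A₀ : Subalgebra ℂ A) (A₂ : Subalgebra ℂ (CStarTensor k A A)) (σc : ℂ → A₀ ≃ₐ[ℂ] A₀),
    IsCompactQuantumHypergroupOn Δ ε inv σ μ A₀ A₂ σc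

end Hypergroups

end QHyp

open QHyp

/-!
A conditional expectation `P : A → B` is completely positive, because the quadratic form of a matrix
`P (aᵢ* aⱼ)` at `d` is `P (y* y)` with `y = ∑ aᵢ dᵢ` (`IsConditionalExpectation.isUCP`). So `P ⊗ P`
is defined and completely positive on either C*-tensor product (`exists_tensorMap`), and it is a left
inverse of `ι ⊗ ι`, with `ι : B → A` the inclusion. The comultiplication of `B` is
`ΔB = (P ⊗ P) Δ ι`, a composition of unital completely positive maps, and the coideal condition says
that `ΔB P = (P ⊗ P) Δ`: the surjection `P` intertwines all the structure. Hence every axiom of `B`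
is the image of an axiom of `A`, the intertwining relations being checked on elementary tensors
(`CStarTensor.hom_ext`): coassociativity and `Δ ⋆ = Σ (⋆ ⊗ ⋆) Δ` in
`IsHypergroupStructure.restrict`, invariance of `μ` in `IsHaarMeasure.restrict`, density of the
positive definite elements through `IsPositiveDefinite.map`. Strong invariance follows by applying
`P` to that of `A`, as `P` is a `B`-bimodule map which commutes with `*`, `⋆`, `σ_t` and preserves
`μ`. The complex one-parameter groups act on `A₀ ∩ B` and on the preimage of `A₂` under `ι ⊗ ι`: a
bounded map commuting with `σ_t` for real `t` commutes with the entire extension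
(`IsComplexExtension.exists_restrict`).

All the maps on tensor products have to be shown to exist. A completely positive map `Φ = φ ⊗ ψ` of
algebraic tensor products satisfies the Kadison-Schwarz inequality `Φ(x)* Φ(x) ≤ Φ(x* x)`, so
boundedness reduces to `ω' (x* x) ≤ ‖x‖² ω' 1` for the functionals `ω' = ω (y* Φ(·) y)`. This is
immediate for the projective norm, and for the injective one it follows from any bound for `ω'` by
the Cauchy-Schwarz inequality for the powers of `x* x` (`IsPositiveFunctional.apply_le_of_bound`).
For the associator of the injective tensor product, triple products of states form a faithful family
(`eq_zero_of_forall_prod_state`), and such families determine the norm (`norm_le_of_faithful`).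
-/

namespace QHyp

/-! ### Positive matrices over a C*-algebra -/

section PSD

/-- Mathlib states this for algebras with a functional calculus; here the C*-algebra structure
provides it. -/
theorem nonneg_iff_exists_star_mul_self {X : Type*} [NonUnitalCStarAlgebra X] [PartialOrder X]
    [StarOrderedRing X] {x : X} : 0 ≤ x ↔ ∃ y, x = star y * y :=
  CStarAlgebra.nonneg_iff_eq_star_mul_self

/-- The negative part `N = S* S` of a self-adjoint element `x` satisfies
`N x N = -N³ = -(S N)* (S N)`, and it vanishes as soon as `S N` does. -/
theorem exists_negPart_sandwich {X : Type*} [NonUnitalCStarAlgebra X] [PartialOrder X]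
    [StarOrderedRing X] {x : X} (hx : IsSelfAdjoint x) :
    ∃ N S : X, star N = N ∧ N * x * N = -(star (S * N) * (S * N)) ∧ (S * N = 0 → 0 ≤ x) := by
  obtain ⟨S, hS⟩ := nonneg_iff_exists_star_mul_self.1 (CFC.negPart_nonneg x)
  have hNa : star (x⁻) = x⁻ := (IsSelfAdjoint.of_nonneg (CFC.negPart_nonneg x)).star_eq
  have hR : star (S * x⁻) * (S * x⁻) = x⁻ * x⁻ * x⁻ := by
    rw [star_mul, hNa, mul_assoc, ← mul_assoc (star S), ← hS, mul_assoc]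
  refine ⟨x⁻, S, hNa, ?_, fun h => ?_⟩
  · have e : x⁻ * x = -(x⁻ * x⁻) := by
      calc x⁻ * x = x⁻ * (x⁺ - x⁻) := by rw [CFC.posPart_sub_negPart x hx]
        _ = -(x⁻ * x⁻) := by rw [mul_sub, CFC.negPart_mul_posPart, zero_sub]
    rw [hR, e, neg_mul]
  · rw [h, mul_zero] at hR
    have hN2 : x⁻ * x⁻ = 0 := by
      rw [← CStarRing.star_mul_self_eq_zero_iff, star_mul, hNa, ← mul_assoc, ← hR, zero_mul]
    have hN1 : x⁻ = 0 := by
      rw [← CStarRing.star_mul_self_eq_zero_iff, hNa, hN2]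
    exact (CFC.negPart_eq_zero_iff x hx).1 hN1

variable {C : Type*} [CStarAlgebra C] {n : Type*} [Fintype n]

/-- The matrix `M` over the C*-algebra `C` is positive: `M = N* N` for a square matrix `N`. -/
def IsPSD (M : n → n → C) : Prop :=
  ∃ N : n → n → C, ∀ i j, M i j = ∑ k, star (N k i) * N k j

theorem isPSD_iff_nonneg [PartialOrder C] [StarOrderedRing C] {M : n → n → C} :
    IsPSD M ↔ 0 ≤ CStarMatrix.ofMatrix (Matrix.of M) := by
  rw [nonneg_iff_exists_star_mul_self]
  constructor
  · rintro ⟨N, hN⟩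
    refine ⟨CStarMatrix.ofMatrix (Matrix.of N), ?_⟩
    ext i j
    simp [CStarMatrix.mul_apply, CStarMatrix.star_apply, hN]
  · rintro ⟨N, hN⟩
    refine ⟨fun i j => N i j, fun i j => ?_⟩
    have := congrArg (fun Q : CStarMatrix n n C => Q i j) hN
    simpa [CStarMatrix.mul_apply, CStarMatrix.star_apply] using this

theorem exists_star_mul_self_sum {K : Type*} (s : Finset K) (v : K → C) :
    ∃ e, ∑ k ∈ s, star (v k) * v k = star e * e := by
  let _ := CStarAlgebra.spectralOrder C
  let _ := CStarAlgebra.spectralOrderedRing C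
  exact nonneg_iff_exists_star_mul_self.1
    (Finset.sum_nonneg fun k _ => star_mul_self_nonneg (v k))

/-- A matrix over a C*-algebra is positive as soon as all its quadratic forms are. With `N` its
negative part, the diagonal entries of `N M N = -N³` are quadratic forms, whence `N = 0`. -/
theorem isPSD_of_forall {M : n → n → C} (herm : ∀ i j, star (M i j) = M j i)
    (h : ∀ d : n → C, ∃ e, ∑ i, ∑ j, star (d i) * M i j * d j = star e * e) : IsPSD M := by
  let _ := CStarAlgebra.spectralOrder C
  let _ := CStarAlgebra.spectralOrderedRing C
  rw [isPSD_iff_nonneg]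
  set X : CStarMatrix n n C := CStarMatrix.ofMatrix (Matrix.of M) with hX
  have hXa : IsSelfAdjoint X := by
    ext i j
    simp [CStarMatrix.star_apply, hX, herm]
  obtain ⟨N, S, hNa, hNX, hN⟩ := exists_negPart_sandwich hXa
  set R := S * N with hR
  have hdiag : ∀ p, (star R * R) p p = 0 := by
    intro p
    obtain ⟨e, he⟩ := h fun i => N i p
    apply le_antisymm
    · have h3 : (N * X * N) p p = star e * e := by
        rw [← he, CStarMatrix.mul_apply]
        simp only [CStarMatrix.mul_apply, Finset.sum_mul]
        rw [Finset.sum_comm]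
        refine Finset.sum_congr rfl fun i _ => Finset.sum_congr rfl fun j _ => ?_
        have : N p i = star (N i p) := by
          conv_lhs => rw [← hNa]
          rfl
        rw [this]; rfl
      rw [← neg_nonneg, ← CStarMatrix.neg_apply, ← hNX, h3]
      exact star_mul_self_nonneg e
    · rw [CStarMatrix.mul_apply]
      exact Finset.sum_nonneg fun k _ => star_mul_self_nonneg (R k p)
  refine hN ?_
  ext k p
  have h4 := hdiag p
  rw [CStarMatrix.mul_apply] at h4
  have := (Finset.sum_eq_zero_iff_of_nonneg
    (fun k _ => star_mul_self_nonneg (R k p))).1 h4 k (Finset.mem_univ k)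
  exact CStarRing.star_mul_self_eq_zero_iff (R k p) |>.1 this

theorem isClosed_setOf_nonneg {X : Type*} [NonUnitalCStarAlgebra X] [PartialOrder X]
    [StarOrderedRing X] : IsClosed {x : X | 0 ≤ x} := CStarAlgebra.isClosed_nonneg

/-- Gram matrices with vectors indexed by an arbitrary finite type are positive. -/
theorem isPSD_of_gram {K : Type*} [Fintype K] {M : n → n → C} (w : K → n → C)
    (h : ∀ i j, M i j = ∑ k, star (w k i) * w k j) : IsPSD M := by
  refine isPSD_of_forall (fun i j => by simp [h]) fun d => ?_
  obtain ⟨e, he⟩ := exists_star_mul_self_sum Finset.univ fun k => ∑ i, w k i * d i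
  refine ⟨e, he ▸ ?_⟩
  simp only [h, star_sum, star_mul, Finset.mul_sum, Finset.sum_mul]
  rw [Finset.sum_comm]
  conv_rhs => rw [Finset.sum_comm]
  refine Finset.sum_congr rfl fun i _ => ?_
  rw [Finset.sum_comm]
  refine Finset.sum_congr rfl fun j _ => Finset.sum_congr rfl fun k _ => ?_
  simp only [mul_assoc]

theorem isClosed_isPSD : IsClosed {M : n → n → C | IsPSD M} := by
  classical
  let _ := CStarAlgebra.spectralOrder C
  let _ := CStarAlgebra.spectralOrderedRing C
  have h : Continuous fun M : n → n → C => CStarMatrix.ofMatrix (Matrix.of M) := continuous_id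
  have := (isClosed_setOf_nonneg (X := CStarMatrix n n C)).preimage h
  convert this using 1
  ext M
  exact isPSD_iff_nonneg

end PSD

/-! ### Unital completely positive maps -/

section UCP

variable {A C D : Type*} [CStarAlgebra A] [CStarAlgebra C] [CStarAlgebra D]

/-- Unital completely positive maps, with complete positivity expressed by Gram matrices: all
matrices `φ (aᵢ* aⱼ)` are positive. -/
structure IsUCP (φ : A →ₗ[ℂ] C) : Prop where
  map_one : φ 1 = 1
  gram : ∀ (n : ℕ) (a : Fin n → A), IsPSD fun i j => φ (star (a i) * a j)

theorem IsUCP.exists_gram {φ : A →ₗ[ℂ] C} (h : IsUCP φ) {n : Type*} [Fintype n] (a : n → A) :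
    ∃ (m : ℕ) (c : Fin m → n → C),
      ∀ i j, φ (star (a i) * a j) = ∑ k, star (c k i) * c k j := by
  let e := Fintype.equivFin n
  obtain ⟨N, hN⟩ := h.gram _ (a ∘ e.symm)
  exact ⟨_, fun k i => N k (e i), fun i j => by simpa using hN (e i) (e j)⟩

theorem IsUCP.exists_star_mul_self {φ : A →ₗ[ℂ] C} (h : IsUCP φ) (a : A) :
    ∃ c, φ (star a * a) = star c * c := by
  obtain ⟨m, c, hc⟩ := h.exists_gram fun _ : Unit => a
  obtain ⟨e, he⟩ := exists_star_mul_self_sum Finset.univ fun k => c k ()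
  exact ⟨e, (hc () ()).trans he⟩

theorem IsUCP.comp {φ : A →ₗ[ℂ] C} {ψ : C →ₗ[ℂ] D} (hψ : IsUCP ψ) (hφ : IsUCP φ) :
    IsUCP (ψ ∘ₗ φ) := by
  refine ⟨by simp [hφ.map_one, hψ.map_one], fun n a => ?_⟩
  obtain ⟨m, c, hc⟩ := hφ.exists_gram a
  choose l d hd using fun k => hψ.exists_gram (c k)
  refine isPSD_of_gram (K := Σ k, Fin (l k)) (fun k => d k.1 k.2) fun i j => ?_
  rw [LinearMap.comp_apply, hc, map_sum, Fintype.sum_sigma]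
  exact Finset.sum_congr rfl fun k _ => hd k i j

theorem IsUCP.of_starHom (φ : A →⋆ₐ[ℂ] C) : IsUCP (φ : A →ₐ[ℂ] C).toLinearMap :=
  ⟨_root_.map_one φ, fun _ a => isPSD_of_gram (K := Unit) (fun _ i => φ (a i)) fun i j => by
    simp [map_star]⟩

theorem isUCP_id : IsUCP (LinearMap.id : A →ₗ[ℂ] A) :=
  IsUCP.of_starHom (StarAlgHom.id ℂ A)

theorem IsUCP.isPositiveMap {φ : A →ₗ[ℂ] C} (h : IsUCP φ) : IsPositiveMap φ := by
  let _ := CStarAlgebra.spectralOrder A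
  let _ := CStarAlgebra.spectralOrder C
  let _ := CStarAlgebra.spectralOrderedRing A
  let _ := CStarAlgebra.spectralOrderedRing C
  intro a ha
  obtain ⟨b, rfl⟩ := CStarAlgebra.nonneg_iff_eq_star_mul_self.1 ha
  obtain ⟨c, hc⟩ := h.exists_star_mul_self b
  rw [hc]
  exact star_mul_self_nonneg c

theorem IsPositiveMap.continuous {φ : A →ₗ[ℂ] C} (h : IsPositiveMap φ) : Continuous φ := by
  let _ := CStarAlgebra.spectralOrder A
  let _ := CStarAlgebra.spectralOrder C
  let _ := CStarAlgebra.spectralOrderedRing A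
  let _ := CStarAlgebra.spectralOrderedRing C
  exact map_continuous (PositiveLinearMap.mk₀ φ h)

theorem IsPositiveMap.map_star {φ : A →ₗ[ℂ] C} (h : IsPositiveMap φ) (a : A) :
    φ (star a) = star (φ a) := by
  let _ := CStarAlgebra.spectralOrder A
  let _ := CStarAlgebra.spectralOrder C
  let _ := CStarAlgebra.spectralOrderedRing A
  let _ := CStarAlgebra.spectralOrderedRing C
  exact StarHomClass.map_star (PositiveLinearMap.mk₀ φ h) a

theorem IsUCP.isCompletelyPositive {φ : A →ₗ[ℂ] C} (h : IsUCP φ) : IsCompletelyPositive φ := by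
  let _ := CStarAlgebra.spectralOrder A
  let _ := CStarAlgebra.spectralOrder C
  let _ := CStarAlgebra.spectralOrderedRing A
  let _ := CStarAlgebra.spectralOrderedRing C
  refine ⟨⟨φ, fun k M hM => ?_⟩, rfl⟩
  obtain ⟨N, hN⟩ := (isPSD_iff_nonneg (M := fun i j => M i j)).2 hM
  replace hN : ∀ i j, M i j = ∑ k, star (N k i) * N k j := hN
  refine (isPSD_iff_nonneg (M := fun i j => φ (M i j))).1 ?_
  choose l d hd using fun p => h.exists_gram (N p)
  refine isPSD_of_gram (K := Σ k, Fin (l k)) (fun k => d k.1 k.2) fun i j => ?_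
  rw [hN, map_sum, Fintype.sum_sigma]
  exact Finset.sum_congr rfl fun p _ => hd p i j

theorem IsCompletelyPositive.isUCP {φ : A →ₗ[ℂ] C} (h : IsCompletelyPositive φ)
    (h1 : φ 1 = 1) : IsUCP φ := by
  let _ := CStarAlgebra.spectralOrder A
  let _ := CStarAlgebra.spectralOrder C
  let _ := CStarAlgebra.spectralOrderedRing A
  let _ := CStarAlgebra.spectralOrderedRing C
  obtain ⟨Φ, rfl⟩ := h
  refine ⟨h1, fun n a => ?_⟩
  refine isPSD_iff_nonneg.2 (Φ.map_cstarMatrix_nonneg' n _ (isPSD_iff_nonneg.1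
    (isPSD_of_gram (M := fun i j => star (a i) * a j) (K := Unit) (fun _ i => a i) fun i j => ?_)))
  simp

end UCP

/-! ### States -/

section States

variable {A : Type*} [CStarAlgebra A]

theorem IsState.isUCP {f : A →L[ℂ] ℂ} (hf : IsState f) : IsUCP (f : A →ₗ[ℂ] ℂ) := by
  refine ⟨hf.map_one, fun n a => isPSD_of_forall (fun i j => ?_) fun d => ?_⟩
  · exact IsPositiveFunctional.conj_apply (ω := (f : A →ₗ[ℂ] ℂ)) hf.nonneg (a j) (a i)
  · have h := hf.nonneg (∑ i, d i • a i)
    refine CStarAlgebra.nonneg_iff_eq_star_mul_self.1 (h.trans_eq ?_)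
    simp only [star_sum, star_smul, Finset.sum_mul, Finset.mul_sum, map_sum, smul_mul_assoc,
      mul_smul_comm, map_smul, smul_eq_mul]
    rw [Finset.sum_comm]
    refine Finset.sum_congr rfl fun i _ => Finset.sum_congr rfl fun j _ => ?_
    rw [ContinuousLinearMap.coe_coe]
    ring

/-- A functional of norm at most one taking the value one at the unit is a state. -/
theorem isState_of_norm_le_one {f : A →L[ℂ] ℂ} (hf : ‖f‖ ≤ 1) (h1 : f 1 = 1) : IsState f := by
  let _ := CStarAlgebra.spectralOrder A
  let _ := CStarAlgebra.spectralOrderedRing A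
  have hle : ∀ a, ‖f a‖ ≤ ‖a‖ := fun a => f.le_of_opNorm_le hf a |>.trans_eq (one_mul _)
  -- `f` is real on self-adjoint elements because `‖h + i t‖² ≤ ‖h‖² + t²` for all real `t`
  have hreal : ∀ h : A, IsSelfAdjoint h → (f h).im = 0 := by
    intro h hh
    have key : ∀ t : ℝ, ((f h).im + t) ^ 2 ≤ ‖h‖ ^ 2 + t ^ 2 := by
      intro t
      have e1 : star (h + (t * Complex.I) • (1 : A)) * (h + (t * Complex.I) • (1 : A))
          = h * h + ((t ^ 2 : ℝ) : ℂ) • (1 : A) := by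
        have e2 : star ((t : ℂ) * Complex.I) = -((t : ℂ) * Complex.I) := by simp
        have e3 : (t : ℂ) * Complex.I * -(t * Complex.I) = ((t ^ 2 : ℝ) : ℂ) := by
          push_cast
          linear_combination (-(t : ℂ) ^ 2) * Complex.I_sq
        simp only [star_add, star_smul, star_one, hh.star_eq, e2, add_mul, mul_add, smul_mul_assoc,
          mul_smul_comm, one_mul, mul_one, smul_add, smul_smul]
        rw [e3, neg_smul]
        abel
      have e4 : ‖h + (t * Complex.I) • (1 : A)‖ ^ 2 ≤ ‖h‖ ^ 2 + t ^ 2 := by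
        rw [sq, ← CStarRing.norm_star_mul_self, e1]
        refine (norm_add_le _ _).trans (add_le_add ((norm_mul_le _ _).trans_eq (sq _).symm) ?_)
        rw [norm_smul, Complex.norm_real, Real.norm_of_nonneg (sq_nonneg t)]
        refine mul_le_of_le_one_right (sq_nonneg t) ?_
        rcases subsingleton_or_nontrivial A with hA | hA
        · simp [Subsingleton.elim (1 : A) 0]
        · rw [CStarRing.norm_one]
      have e5 : f (h + (t * Complex.I) • (1 : A)) = f h + t * Complex.I := by
        simp [h1]
      have e6 : ((f h).im + t) ≤ ‖f (h + (t * Complex.I) • (1 : A))‖ ∧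
          -((f h).im + t) ≤ ‖f (h + (t * Complex.I) • (1 : A))‖ := by
        have := Complex.abs_im_le_norm (f (h + (t * Complex.I) • (1 : A)))
        rw [e5] at this ⊢
        simp only [Complex.add_im, Complex.mul_im, Complex.ofReal_re, Complex.I_im, mul_one,
          Complex.ofReal_im, Complex.I_re, mul_zero, add_zero] at this
        exact ⟨(le_abs_self _).trans this, (neg_le_abs _).trans this⟩
      refine le_trans ?_ (le_trans (pow_le_pow_left₀ (norm_nonneg _)
        (hle (h + (t * Complex.I) • (1 : A))) 2) e4)
      exact sq_le_sq' (by linarith [e6.2]) e6.1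
    by_contra hne
    have := key ((‖h‖ ^ 2 + 1) / (2 * (f h).im))
    have e7 : 2 * (f h).im * ((‖h‖ ^ 2 + 1) / (2 * (f h).im)) = ‖h‖ ^ 2 + 1 := by
      field_simp
    nlinarith [sq_nonneg (f h).im]
  have hpos : ∀ p : A, 0 ≤ p → ‖p‖ ≤ 1 → 0 ≤ (f p).re := by
    intro p hp hp1
    have e1 : ‖1 - p‖ ≤ 1 := by
      refine (CStarAlgebra.norm_le_one_iff_of_nonneg (1 - p) ?_).2 (sub_le_self 1 hp)
      exact sub_nonneg.2 ((CStarAlgebra.norm_le_one_iff_of_nonneg p hp).1 hp1)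
    have e2 := (Complex.re_le_norm _).trans ((hle (1 - p)).trans e1)
    rw [map_sub, h1, Complex.sub_re, Complex.one_re] at e2
    linarith
  refine ⟨fun a => ?_, h1⟩
  rw [Complex.le_def]
  refine ⟨?_, (hreal _ (.star_mul_self a)).symm⟩
  rcases eq_or_ne a 0 with rfl | ha
  · simp
  have hn : 0 < ‖a‖⁻¹ := inv_pos.2 (norm_pos_iff.2 ha)
  have := hpos (star (((‖a‖⁻¹ : ℝ) : ℂ) • a) * (((‖a‖⁻¹ : ℝ) : ℂ) • a)) (star_mul_self_nonneg _) (by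
    rw [CStarRing.norm_star_mul_self, norm_smul, Complex.norm_real, Real.norm_of_nonneg hn.le,
      inv_mul_cancel₀ (norm_ne_zero_iff.2 ha), one_mul])
  simp only [star_smul, smul_mul_assoc, mul_smul_comm, map_smul, smul_smul, RCLike.star_def,
    Complex.conj_ofReal, smul_eq_mul, ← Complex.ofReal_mul, Complex.re_ofReal_mul] at this
  exact (mul_nonneg_iff_of_pos_left (mul_pos hn hn)).1 this

/-- States attain the norm of positive elements: Hahn-Banach is applied at `p + ‖p‖ 1`, which has
norm `2 ‖p‖`, where `p = a* a`. -/
theorem exists_isState_apply [Nontrivial A] (a : A) :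
    ∃ f : A →L[ℂ] ℂ, IsState f ∧ f (star a * a) = ((‖a‖ ^ 2 : ℝ) : ℂ) := by
  let _ := CStarAlgebra.spectralOrder A
  let _ := CStarAlgebra.spectralOrderedRing A
  rcases eq_or_ne a 0 with rfl | ha
  · obtain ⟨f, hf, hf1⟩ := exists_dual_vector' ℂ (1 : A)
    exact ⟨f, isState_of_norm_le_one hf.le (by simpa using hf1), by simp⟩
  set p := star a * a with hp
  set r : ℝ := ‖a‖ ^ 2 with hr
  have hr0 : 0 < r := by positivity
  have hpr : ‖p‖ = r := by rw [hp, CStarRing.norm_star_mul_self, hr, sq]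
  have hple : p ≤ (r : ℂ) • (1 : A) := by
    have := IsSelfAdjoint.le_algebraMap_norm_self (a := p) (.star_mul_self a)
    rwa [hpr, Algebra.algebraMap_eq_smul_one, ← Complex.coe_smul] at this
  have hnorm : 2 * r ≤ ‖p + (r : ℂ) • (1 : A)‖ := by
    have h2 : p + p ≤ p + (r : ℂ) • (1 : A) := by gcongr
    have h0 : 0 ≤ p := star_mul_self_nonneg a
    have := CStarAlgebra.norm_le_norm_of_nonneg_of_le (add_nonneg h0 h0) h2
    rwa [← two_smul ℂ p, norm_smul, hpr, Complex.norm_ofNat] at this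
  obtain ⟨f, hf, hf1⟩ := exists_dual_vector'' ℂ (p + (r : ℂ) • (1 : A))
  have hfp : ‖f p‖ ≤ r := (f.le_of_opNorm_le hf p).trans_eq (by rw [hpr, one_mul])
  have hfo : ‖f 1‖ ≤ 1 := (f.le_of_opNorm_le hf 1).trans_eq (by rw [CStarRing.norm_one, one_mul])
  have hsum : 2 * r ≤ (f p).re + r * (f 1).re := by
    have := congrArg Complex.re hf1
    simp only [map_add, map_smul, smul_eq_mul, Complex.add_re, Complex.re_ofReal_mul] at this
    rw [this]
    exact hnorm
  have hre1 := (Complex.re_le_norm (f p)).trans hfp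
  have hre2 := (Complex.re_le_norm (f 1)).trans hfo
  have hp1 : (f p).re = r := by nlinarith
  have ho1 : (f 1).re = 1 := by nlinarith
  have eq_of : ∀ (z : ℂ) (s : ℝ), ‖z‖ ≤ s → z.re = s → z = s := by
    intro z s hz hs
    have h3 := Complex.sq_norm z
    rw [Complex.normSq_apply, hs] at h3
    have h4 : z.im * z.im ≤ 0 := by nlinarith [norm_nonneg z]
    have h5 : z.im = 0 := mul_self_eq_zero.1 (le_antisymm h4 (mul_self_nonneg _))
    exact Complex.ext (by simpa using hs) (by simpa using h5)
  refine ⟨f, isState_of_norm_le_one hf ?_, eq_of _ _ hfp hp1⟩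
  simpa using eq_of _ 1 hfo ho1

end States

/-! ### Functionals bounded by a submultiplicative seminorm -/

section PowerTrick

variable {E : Type*} [Ring E] [StarRing E] [Algebra ℂ E] [StarModule ℂ E]

theorem IsPositiveFunctional.re_nonneg {ω : E →ₗ[ℂ] ℂ} (h : IsPositiveFunctional ω) (x : E) :
    0 ≤ (ω (star x * x)).re := (Complex.le_def.1 (h x)).1

/-- A positive functional which is bounded by a multiple of a submultiplicative function `p`
satisfies the bound with the constant `ω 1` on positive elements: by the Cauchy-Schwarz inequality
`(ω t / ω 1) ^ N ≤ ω (t ^ N) / ω 1` for `N = 2 ^ n`, and the constant disappears in the limit. -/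
theorem IsPositiveFunctional.apply_le_of_bound {ω : E →ₗ[ℂ] ℂ} (h : IsPositiveFunctional ω)
    {p : E → ℝ} (hp0 : ∀ x, 0 ≤ p x) (hp : ∀ x y, p (x * y) ≤ p x * p y) {K : ℝ}
    (hK : ∀ x, ‖ω x‖ ≤ K * p x) (x : E) :
    (ω (star x * x)).re ≤ p (star x * x) * (ω 1).re := by
  set t := star x * x with ht
  have hts : ∀ m, star (t ^ m) = t ^ m := fun m => by simp [ht]
  set c := (ω 1).re with hc
  have hc1 : gnsVec ω 1 ^ 2 = c := by rw [gnsVec_sq h, star_one, one_mul]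
  have hc0 : 0 ≤ c := hc1 ▸ sq_nonneg _
  set a : ℕ → ℝ := fun n => (ω (t ^ 2 ^ n)).re with ha
  have hstep : ∀ n, a n ^ 2 ≤ c * a (n + 1) := by
    intro n
    have h1 := gnsVec_inner_le h 1 (t ^ 2 ^ n)
    rw [star_one, one_mul] at h1
    have h2 : |a n| ≤ gnsVec ω 1 * gnsVec ω (t ^ 2 ^ n) := (Complex.abs_re_le_norm _).trans h1
    have h3 : gnsVec ω (t ^ 2 ^ n) ^ 2 = a (n + 1) := by
      rw [gnsVec_sq h, hts, ← pow_add, ← two_mul, ← pow_succ']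
    calc a n ^ 2 = |a n| ^ 2 := (sq_abs _).symm
      _ ≤ (gnsVec ω 1 * gnsVec ω (t ^ 2 ^ n)) ^ 2 := pow_le_pow_left₀ (abs_nonneg _) h2 2
      _ = c * a (n + 1) := by rw [mul_pow, hc1, h3]
  have ha0 : 0 ≤ a 0 := by simpa [ha] using h.re_nonneg x
  have hat : (ω t).re = a 0 := by simp [ha]
  rw [hat]
  rcases hc0.eq_or_lt with hcz | hcpos
  · have := hstep 0
    rw [← hcz, zero_mul] at this
    have h0 : a 0 = 0 := by nlinarith
    rw [h0, ← hcz, mul_zero]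
  have hpow : ∀ n, a 0 ^ 2 ^ n * c ≤ c ^ 2 ^ n * a n := by
    intro n
    induction n with
    | zero => simp [mul_comm]
    | succ n ih =>
      have h1 : (a 0 ^ 2 ^ n * c) ^ 2 ≤ (c ^ 2 ^ n * a n) ^ 2 :=
        pow_le_pow_left₀ (by positivity) ih 2
      have h2 : (c ^ 2 ^ n * a n) ^ 2 ≤ c ^ 2 ^ (n + 1) * (c * a (n + 1)) := by
        rw [mul_pow, ← pow_mul, ← pow_succ]
        exact mul_le_mul_of_nonneg_left (hstep n) (by positivity)
      have h3 : (a 0 ^ 2 ^ n * c) ^ 2 = a 0 ^ 2 ^ (n + 1) * c * c := by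
        rw [mul_pow, ← pow_mul, ← pow_succ]; ring
      rw [h3] at h1
      have h4 := h1.trans h2
      rw [mul_comm c, ← mul_assoc] at h4
      exact le_of_mul_le_mul_right h4 hcpos
  have hpp : ∀ m, p (t ^ (m + 1)) ≤ p t ^ (m + 1) := by
    intro m
    induction m with
    | zero => simp
    | succ m ih =>
      rw [pow_succ, pow_succ (p t)]
      exact (hp _ _).trans (mul_le_mul_of_nonneg_right ih (hp0 t))
  have hpp' : ∀ n, p (t ^ 2 ^ n) ≤ p t ^ 2 ^ n := by
    intro n
    obtain ⟨m, hm⟩ := Nat.exists_eq_succ_of_ne_zero (pow_ne_zero n (two_ne_zero (α := ℕ)))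
    rw [hm]; exact hpp m
  have hK0 : 0 ≤ K := by
    by_contra hneg
    have h1 := hK 1
    have h2 : 0 < ‖ω 1‖ := norm_pos_iff.2 fun h0 => by simp [hc, h0] at hcpos
    nlinarith [hp0 (1 : E)]
  by_contra! hlt
  set s := p t * c with hs
  have hs0 : 0 ≤ s := mul_nonneg (hp0 t) hc0
  have hu : 0 < a 0 := hs0.trans_lt hlt
  have hfin : ∀ n : ℕ, c ≤ K * (s / a 0) ^ 2 ^ n := by
    intro n
    have h1 : c ^ 2 ^ n * a n ≤ K * s ^ 2 ^ n := by
      have h2 : a n ≤ K * p t ^ 2 ^ n := (Complex.re_le_norm _).trans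
        ((hK _).trans (mul_le_mul_of_nonneg_left (hpp' n) hK0))
      calc c ^ 2 ^ n * a n ≤ c ^ 2 ^ n * (K * p t ^ 2 ^ n) :=
            mul_le_mul_of_nonneg_left h2 (by positivity)
        _ = K * s ^ 2 ^ n := by rw [hs, mul_pow]; ring
    rw [div_pow, ← mul_div_assoc, le_div_iff₀ (by positivity), mul_comm]
    exact (hpow n).trans h1
  have hlim : Filter.Tendsto (fun n : ℕ => K * (s / a 0) ^ 2 ^ n) Filter.atTop (nhds (K * 0)) :=
    (((tendsto_pow_atTop_nhds_zero_of_lt_one (div_nonneg hs0 hu.le)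
      ((div_lt_one hu).2 hlt)).comp
        (tendsto_pow_atTop_atTop_of_one_lt (one_lt_two (α := ℕ))))).const_mul K
  have := ge_of_tendsto' hlim hfin
  linarith

/-- The functional `z ↦ ω (y* z y)`. -/
noncomputable def conjFunctional (ω : E →ₗ[ℂ] ℂ) (y : E) : E →ₗ[ℂ] ℂ :=
  ω ∘ₗ LinearMap.mulLeft ℂ (star y) ∘ₗ LinearMap.mulRight ℂ y

@[simp]
theorem conjFunctional_apply (ω : E →ₗ[ℂ] ℂ) (y z : E) :
    conjFunctional ω y z = ω (star y * (z * y)) := rfl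

theorem conjFunctional_star_mul_self (ω : E →ₗ[ℂ] ℂ) (y z : E) :
    conjFunctional ω y (star z * z) = ω (star (z * y) * (z * y)) := by
  rw [conjFunctional_apply, star_mul]
  simp only [mul_assoc]

theorem IsPositiveFunctional.conjFunctional {ω : E →ₗ[ℂ] ℂ} (h : IsPositiveFunctional ω) (y : E) :
    IsPositiveFunctional (QHyp.conjFunctional ω y) := fun z => by
  rw [conjFunctional_star_mul_self]
  exact h _

end PowerTrick

/-! ### The C*-tensor product as a completion -/

section Completion

variable {A B : Type*} [CStarAlgebra A] [CStarAlgebra B] (k : CStarTensorKind)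

/-- The canonical `*`-homomorphism of the algebraic tensor product to the C*-tensor product. -/
noncomputable def ofAlg : A ⊗[ℂ] B →⋆ₐ[ℂ] CStarTensor k A B where
  toFun x := AlgTensor.toCStar k x
  map_one' := UniformSpace.Completion.coe_one (AlgTensor k A B)
  map_mul' x y := toCStar_mul x y
  map_zero' := UniformSpace.Completion.coe_zero
  map_add' x y := toCStar_add x y
  commutes' r := by
    have h1 : algebraMap ℂ (A ⊗[ℂ] B) r = r • 1 := Algebra.algebraMap_eq_smul_one r
    rw [h1, Algebra.algebraMap_eq_smul_one]
    refine (toCStar_smul (k := k) r (1 : AlgTensor k A B)).trans ?_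
    exact congrArg (r • ·) (UniformSpace.Completion.coe_one (AlgTensor k A B))
  map_star' x := (toCStar_star (k := k) x).symm

variable {k}

@[simp]
theorem ofAlg_tmul (a : A) (b : B) : ofAlg k (a ⊗ₜ[ℂ] b) = tmul k a b := rfl

theorem norm_ofAlg (x : A ⊗[ℂ] B) : ‖ofAlg k x‖ = gnsNorm (testFunctionals k A B) x :=
  norm_toCStar (k := k) x

theorem denseRange_ofAlg : DenseRange (ofAlg k : A ⊗[ℂ] B → CStarTensor k A B) :=
  UniformSpace.Completion.denseRange_coe (α := AlgTensor k A B)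

theorem gnsVec_mul_le_norm {ω : A ⊗[ℂ] B →ₗ[ℂ] ℂ} (hω : ω ∈ testFunctionals k A B)
    (x y : A ⊗[ℂ] B) : gnsVec ω (x * y) ≤ ‖ofAlg k x‖ * gnsVec ω y := by
  rw [norm_ofAlg]
  exact (isAdmissible_testFunctionals k).le_gnsNorm hω x y

theorem norm_ofAlg_le {x : A ⊗[ℂ] B} {C : ℝ} (hC : 0 ≤ C)
    (h : ∀ ω ∈ testFunctionals k A B, ∀ y, gnsVec ω (x * y) ≤ C * gnsVec ω y) :
    ‖ofAlg k x‖ ≤ C := by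
  rw [norm_ofAlg]
  exact gnsNorm_le hC h

theorem isPositiveFunctional_of_mem {ω : A ⊗[ℂ] B →ₗ[ℂ] ℂ} (hω : ω ∈ testFunctionals k A B) :
    IsPositiveFunctional ω := (isAdmissible_testFunctionals k).1 ω hω

theorem algProd_mem_testFunctionals {f : A →L[ℂ] ℂ} {g : B →L[ℂ] ℂ} (hf : IsState f)
    (hg : IsState g) : algProd f g ∈ testFunctionals k A B := by
  cases k with
  | injective => exact ⟨f, g, hf, hg, rfl⟩
  | projective => exact isPositiveFunctional_algProd hf hg

@[simp]
theorem algProd_tmul (f : A →L[ℂ] ℂ) (g : B →L[ℂ] ℂ) (a : A) (b : B) :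
    algProd f g (a ⊗ₜ[ℂ] b) = f a * g b := rfl

@[simp]
theorem tmul_one_one : tmul k (1 : A) (1 : B) = 1 := map_one (ofAlg k)

@[simp]
theorem tmul_mul_tmul (a a' : A) (b b' : B) :
    tmul k a b * tmul k a' b' = tmul k (a * a') (b * b') := by
  simp only [← ofAlg_tmul, ← map_mul, Algebra.TensorProduct.tmul_mul_tmul]

@[simp]
theorem star_tmul (a : A) (b : B) : star (tmul k a b) = tmul k (star a) (star b) := by
  rw [← ofAlg_tmul, ← map_star, TensorProduct.star_tmul, ofAlg_tmul]

theorem add_tmul (a a' : A) (b : B) : tmul k (a + a') b = tmul k a b + tmul k a' b := by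
  simp only [← ofAlg_tmul, ← map_add, TensorProduct.add_tmul]

theorem tmul_add (a : A) (b b' : B) : tmul k a (b + b') = tmul k a b + tmul k a b' := by
  simp only [← ofAlg_tmul, ← map_add, TensorProduct.tmul_add]

theorem smul_tmul (c : ℂ) (a : A) (b : B) : tmul k (c • a) b = c • tmul k a b := by
  simp only [← ofAlg_tmul, ← map_smul, TensorProduct.smul_tmul']

section Extension

variable {E : Type*} [NormedAddCommGroup E] [NormedSpace ℂ E] {σ : ℂ →+* ℂ}

theorem exists_extension [CompleteSpace E] (f : A ⊗[ℂ] B →ₛₗ[σ] E) (K : ℝ)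
    (h : ∀ x, ‖f x‖ ≤ K * ‖ofAlg k x‖) :
    ∃ F : CStarTensor k A B →SL[σ] E, (∀ x, F (ofAlg k x) = f x) ∧ ∀ x, ‖F x‖ ≤ K * ‖x‖ := by
  let e : A ⊗[ℂ] B →ₗ[ℂ] CStarTensor k A B := (ofAlg k : A ⊗[ℂ] B →⋆ₐ[ℂ] _).toAlgHom.toLinearMap
  have hd : DenseRange e := denseRange_ofAlg
  exact ⟨f.extendOfNorm e, LinearMap.extendOfNorm_eq hd ⟨K, h⟩,
    LinearMap.norm_extendOfNorm_apply_le hd K h⟩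

/-- Continuous semilinear maps agreeing on elementary tensors are equal. -/
theorem CStarTensor.hom_ext {F F' : CStarTensor k A B →SL[σ] E}
    (h : ∀ a b, F (tmul k a b) = F' (tmul k a b)) : F = F' := by
  refine DFunLike.coe_injective (denseRange_ofAlg.equalizer F.continuous F'.continuous ?_)
  funext x
  induction x using TensorProduct.induction_on with
  | zero => simp
  | tmul a b => exact h a b
  | add x y hx hy =>
    simp only [Function.comp_apply, map_add] at hx hy ⊢
    rw [hx, hy]

theorem CStarTensor.hom_ext_apply {F F' : CStarTensor k A B →SL[σ] E}
    (h : ∀ a b, F (tmul k a b) = F' (tmul k a b)) (x : CStarTensor k A B) : F x = F' x := by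
  rw [CStarTensor.hom_ext h]

theorem isTensorExtension_of_clm {G : A → B → E} (F : CStarTensor k A B →SL[σ] E)
    (h : ∀ a b, F (tmul k a b) = G a b) : IsTensorExtension G F :=
  ⟨F.continuous, map_add F, h⟩

theorem tlift_eq_clm {G : A → B → E} (F : CStarTensor k A B →SL[σ] E)
    (h : ∀ a b, F (tmul k a b) = G a b) : tlift G = F :=
  (isTensorExtension_of_clm F h).tlift_eq

end Extension

end Completion

/-! ### Flips and slice maps -/

section Slices

variable {A B C D : Type*} [CStarAlgebra A] [CStarAlgebra B] [CStarAlgebra C] [CStarAlgebra D]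
  {k : CStarTensorKind}

/-- A surjective multiplicative map of algebraic tensor products under which test functionals pull
back to test functionals is contractive. -/
theorem norm_ofAlg_map_le {J : A ⊗[ℂ] B → C ⊗[ℂ] D} (hs : Function.Surjective J)
    (hm : ∀ x y, J (x * y) = J x * J y)
    (hJ : ∀ ω ∈ testFunctionals k C D, ∃ ω' ∈ testFunctionals k A B,
      ∀ x, gnsVec ω (J x) = gnsVec ω' x) (x : A ⊗[ℂ] B) :
    ‖ofAlg k (J x)‖ ≤ ‖ofAlg k x‖ := by
  refine norm_ofAlg_le (norm_nonneg _) fun ω hω y => ?_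
  obtain ⟨y, rfl⟩ := hs y
  obtain ⟨ω', hω', h⟩ := hJ ω hω
  rw [← hm, h, h]
  exact gnsVec_mul_le_norm hω' x y

/-- The flip exists on C*-tensor products. -/
theorem exists_flip :
    ∃ F : CStarTensor k A B →L[ℂ] CStarTensor k B A, ∀ a b, F (tmul k a b) = tmul k b a := by
  let J : A ⊗[ℂ] B ≃ₐ[ℂ] B ⊗[ℂ] A := Algebra.TensorProduct.comm ℂ A B
  have hstar : ∀ x, star (J x) = J (star x) := by
    intro x
    induction x using TensorProduct.induction_on with
    | zero => simp
    | tmul a b => simp [J]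
    | add x y hx hy => rw [star_add, map_add, star_add, map_add, hx, hy]
  have hb := norm_ofAlg_map_le (k := k) (J := J) J.surjective (map_mul J) fun ω hω => by
    refine ⟨ω ∘ₗ J.toLinearMap, ?_, fun x => ?_⟩
    · cases k with
      | injective =>
        obtain ⟨f, g, hf, hg, rfl⟩ := hω
        refine ⟨g, f, hg, hf, TensorProduct.ext' fun a b => ?_⟩
        exact mul_comm _ _
      | projective =>
        intro x
        have := hω (J x)
        rwa [hstar, ← map_mul] at this
    · simp only [gnsVec, hstar, ← map_mul]
      rfl
  obtain ⟨F, hF, -⟩ := exists_extension (k := k)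
    ((ofAlg k : B ⊗[ℂ] A →⋆ₐ[ℂ] _).toAlgHom.toLinearMap ∘ₗ J.toLinearMap) 1
    (fun x => (hb x).trans_eq (one_mul _).symm)
  exact ⟨F, fun a b => hF (a ⊗ₜ b)⟩

theorem gnsVec_algProd_tmul {f : A →L[ℂ] ℂ} {g : B →L[ℂ] ℂ} (a : A) (b : B) {r s : ℝ} (hr : 0 ≤ r)
    (hs : 0 ≤ s) (ha : f (star a * a) = ((r ^ 2 : ℝ) : ℂ)) (hb : g (star b * b) = ((s ^ 2 : ℝ) : ℂ)) :
    gnsVec (algProd f g) (a ⊗ₜ b) = r * s := by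
  rw [gnsVec, TensorProduct.star_tmul, Algebra.TensorProduct.tmul_mul_tmul, algProd_tmul, ha, hb,
    ← Complex.ofReal_mul, Complex.ofReal_re, ← mul_pow, Real.sqrt_sq (mul_nonneg hr hs)]

theorem gnsVec_algProd_le_norm {f : A →L[ℂ] ℂ} {g : B →L[ℂ] ℂ} (hf : IsState f) (hg : IsState g)
    (x : A ⊗[ℂ] B) : gnsVec (algProd f g) x ≤ ‖ofAlg k x‖ := by
  have h1 := gnsVec_mul_le_norm (k := k) (algProd_mem_testFunctionals hf hg) x 1
  have h2 : gnsVec (algProd f g) (1 : A ⊗[ℂ] B) = 1 := by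
    rw [Algebra.TensorProduct.one_def, gnsVec_algProd_tmul (r := 1) (s := 1)] <;>
      simp [hf.map_one, hg.map_one]
  rwa [mul_one, h2, mul_one] at h1

/-- The slice map `id ⊗ g` on the algebraic tensor product. -/
noncomputable def algSlice (g : B →L[ℂ] ℂ) : A ⊗[ℂ] B →ₗ[ℂ] A :=
  (TensorProduct.rid ℂ A).toLinearMap ∘ₗ TensorProduct.map LinearMap.id (g : B →ₗ[ℂ] ℂ)

@[simp]
theorem algSlice_tmul (g : B →L[ℂ] ℂ) (a : A) (b : B) : algSlice g (a ⊗ₜ[ℂ] b) = g b • a := by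
  simp [algSlice]

/-- Slice maps are bounded. Let `z = (id ⊗ g) x`, let `φ` be a state with `φ (z* z) = ‖z‖²` and
`w = (φ (z* ·) ⊗ id) x`, so that `‖z‖² = g w`. If `ψ` is a state with `ψ (w* w) = ‖w‖²`, then
`‖w‖² = (φ ⊗ ψ) ((z ⊗ w)* x) ≤ ‖z‖ ‖w‖ ‖x‖` by the Cauchy-Schwarz inequality. -/
theorem norm_algSlice_le (g : B →L[ℂ] ℂ) (x : A ⊗[ℂ] B) :
    ‖algSlice g x‖ ≤ ‖g‖ * ‖ofAlg k x‖ := by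
  set z := algSlice g x with hz
  rcases eq_or_ne z 0 with hz0 | hz0
  · rw [hz0, norm_zero]; positivity
  have hA : Nontrivial A := ⟨z, 0, hz0⟩
  obtain ⟨φ, hφ, hφz⟩ := exists_isState_apply z
  let L : A ⊗[ℂ] B →ₗ[ℂ] B := (TensorProduct.lid ℂ B).toLinearMap ∘ₗ
    TensorProduct.map ((φ : A →ₗ[ℂ] ℂ) ∘ₗ LinearMap.mulLeft ℂ (star z)) LinearMap.id
  set w := L x with hw
  have hgw : g w = ((‖z‖ ^ 2 : ℝ) : ℂ) := by
    have key : ∀ x', g (L x') = φ (star z * algSlice g x') := by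
      intro x'
      induction x' using TensorProduct.induction_on with
      | zero => simp
      | tmul a b => simp [L, mul_comm]
      | add x y hx hy => rw [map_add, map_add, map_add, mul_add, map_add, hx, hy]
    rw [hw, key, ← hz, hφz]
  have hzn : 0 < ‖z‖ := norm_pos_iff.2 hz0
  have hw0 : w ≠ 0 := by
    intro h0
    rw [h0, map_zero] at hgw
    have : ‖z‖ ^ 2 = 0 := by exact_mod_cast hgw.symm
    exact hz0 (by simpa using this)
  have hB : Nontrivial B := ⟨w, 0, hw0⟩
  have hwn : 0 < ‖w‖ := norm_pos_iff.2 hw0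
  obtain ⟨ψ, hψ, hψw⟩ := exists_isState_apply w
  have key : algProd φ ψ (star (z ⊗ₜ[ℂ] w) * x) = ((‖w‖ ^ 2 : ℝ) : ℂ) := by
    have h0 : ∀ x', algProd φ ψ (star (z ⊗ₜ[ℂ] w) * x') = ψ (star w * L x') := by
      intro x'
      induction x' using TensorProduct.induction_on with
      | zero => simp
      | tmul a b => simp [L]
      | add x y hx hy => rw [map_add, mul_add, mul_add, map_add, map_add, hx, hy]
    rw [h0, ← hw, hψw]
  have h1 := gnsVec_inner_le (isPositiveFunctional_algProd hφ hψ) (z ⊗ₜ[ℂ] w) x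
  rw [key, gnsVec_algProd_tmul z w hzn.le hwn.le hφz hψw, Complex.norm_real,
    Real.norm_of_nonneg (sq_nonneg _)] at h1
  have h2 := h1.trans (mul_le_mul_of_nonneg_left (gnsVec_algProd_le_norm (k := k) hφ hψ x)
    (by positivity))
  have h3 : ‖w‖ ≤ ‖z‖ * ‖ofAlg k x‖ := by
    refine le_of_mul_le_mul_left ?_ hwn
    linarith
  have h4 : ‖z‖ ^ 2 ≤ ‖g‖ * (‖z‖ * ‖ofAlg k x‖) := by
    have h5 := g.le_opNorm w
    rw [hgw, Complex.norm_real, Real.norm_of_nonneg (sq_nonneg _)] at h5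
    exact h5.trans (mul_le_mul_of_nonneg_left h3 (norm_nonneg g))
  refine le_of_mul_le_mul_left ?_ hzn
  linarith

/-- The slice map `id ⊗ g` exists on C*-tensor products. -/
theorem exists_slice_right (g : B →L[ℂ] ℂ) :
    ∃ F : CStarTensor k A B →L[ℂ] A, ∀ a b, F (tmul k a b) = g b • a := by
  obtain ⟨F, hF, -⟩ := exists_extension (k := k) (algSlice (A := A) g) ‖g‖ (norm_algSlice_le g)
  exact ⟨F, fun a b => (hF _).trans (algSlice_tmul g a b)⟩

/-- The slice map `f ⊗ id` exists on C*-tensor products. -/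
theorem exists_slice_left (f : A →L[ℂ] ℂ) :
    ∃ F : CStarTensor k A B →L[ℂ] B, ∀ a b, F (tmul k a b) = f a • b := by
  obtain ⟨F, hF⟩ := exists_slice_right (k := k) (A := B) f
  obtain ⟨S, hS⟩ := exists_flip (k := k) (A := A) (B := B)
  exact ⟨F.comp S, fun a b => by simp [hS, hF]⟩

/-- The functional `f ⊗ g` exists on C*-tensor products, for bounded functionals `f` and `g`. -/
theorem exists_prod_functional (f : A →L[ℂ] ℂ) (g : B →L[ℂ] ℂ) :
    ∃ F : CStarTensor k A B →L[ℂ] ℂ, ∀ a b, F (tmul k a b) = f a * g b := by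
  obtain ⟨F, hF⟩ := exists_slice_right (k := k) (A := A) g
  exact ⟨f.comp F, fun a b => by simp [hF, mul_comm]⟩

end Slices

/-! ### Tensor products of completely positive maps -/

section TensorMaps

variable {A B C D : Type*} [CStarAlgebra A] [CStarAlgebra B] [CStarAlgebra C] [CStarAlgebra D]
  {k : CStarTensorKind}

theorem exists_fin_sum_tmul (x : A ⊗[ℂ] B) :
    ∃ (n : ℕ) (a : Fin n → A) (b : Fin n → B), x = ∑ i, a i ⊗ₜ[ℂ] b i := by
  obtain ⟨s, rfl⟩ := TensorProduct.exists_finset x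
  let e := s.equivFin
  refine ⟨_, fun i => (e.symm i).1.1, fun i => (e.symm i).1.2, ?_⟩
  rw [← Finset.sum_coe_sort s]
  exact (Equiv.sum_comp e.symm fun i : s => i.1.1 ⊗ₜ[ℂ] i.1.2).symm

/-- The algebraic tensor product of unital completely positive maps is completely positive, in an
algebraic sense: the products of the vectors in Gram decompositions for the two factors provide a
Gram decomposition. -/
theorem exists_gram_map {φ : A →ₗ[ℂ] C} {ψ : B →ₗ[ℂ] D} (hφ : IsUCP φ) (hψ : IsUCP ψ)
    {n : Type*} [Fintype n] (x : n → A ⊗[ℂ] B) :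
    ∃ (m : ℕ) (l : ℕ) (w : Fin m × Fin l → n → C ⊗[ℂ] D), ∀ i j,
      TensorProduct.map φ ψ (star (x i) * x j) = ∑ p, star (w p i) * w p j := by
  choose N a b hx using fun i => exists_fin_sum_tmul (x i)
  obtain ⟨m, c, hc⟩ := hφ.exists_gram fun p : Σ i, Fin (N i) => a p.1 p.2
  obtain ⟨l, d, hd⟩ := hψ.exists_gram fun p : Σ i, Fin (N i) => b p.1 p.2
  refine ⟨m, l, fun p i => ∑ q : Fin (N i), c p.1 ⟨i, q⟩ ⊗ₜ[ℂ] d p.2 ⟨i, q⟩, fun i j => ?_⟩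
  have h1 : TensorProduct.map φ ψ (star (x i) * x j) = ∑ q : Fin (N i), ∑ r : Fin (N j),
      φ (star (a i q) * a j r) ⊗ₜ[ℂ] ψ (star (b i q) * b j r) := by
    rw [hx i, hx j, star_sum, Finset.sum_mul, map_sum]
    refine Finset.sum_congr rfl fun q _ => ?_
    rw [Finset.mul_sum, map_sum]
    refine Finset.sum_congr rfl fun r _ => ?_
    rw [TensorProduct.star_tmul, Algebra.TensorProduct.tmul_mul_tmul, TensorProduct.map_tmul]
  rw [h1]
  symm
  simp only [star_sum, Finset.sum_mul_sum, TensorProduct.star_tmul,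
    Algebra.TensorProduct.tmul_mul_tmul]
  rw [Finset.sum_comm]
  refine Finset.sum_congr rfl fun q _ => ?_
  rw [Finset.sum_comm]
  refine Finset.sum_congr rfl fun r _ => ?_
  have h2 := hc ⟨i, q⟩ ⟨j, r⟩
  have h3 := hd ⟨i, q⟩ ⟨j, r⟩
  dsimp only at h2 h3
  rw [h2, h3, TensorProduct.sum_tmul, Fintype.sum_prod_type]
  exact Finset.sum_congr rfl fun s _ => by rw [TensorProduct.tmul_sum]

/-- The Kadison-Schwarz inequality `Φ(x)* Φ(x) ≤ Φ(x* x)`, read off from a Gram decomposition for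
the pair `(1, x)`. -/
theorem exists_kadisonSchwarz {φ : A →ₗ[ℂ] C} {ψ : B →ₗ[ℂ] D} (hφ : IsUCP φ) (hψ : IsUCP ψ)
    (x : A ⊗[ℂ] B) :
    ∃ (m : ℕ) (l : ℕ) (v : Fin m × Fin l → C ⊗[ℂ] D), TensorProduct.map φ ψ (star x * x) =
      star (TensorProduct.map φ ψ x) * TensorProduct.map φ ψ x + ∑ p, star (v p) * v p := by
  obtain ⟨m, l, w, hw⟩ := exists_gram_map hφ hψ fun b : Bool => cond b x 1
  set Φ := TensorProduct.map φ ψ with hΦ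
  have h1 : Φ 1 = 1 := by
    rw [Algebra.TensorProduct.one_def, hΦ, TensorProduct.map_tmul, hφ.map_one, hψ.map_one,
      Algebra.TensorProduct.one_def]
  have htt := hw true true
  have hft := hw false true
  have hff := hw false false
  simp only [cond_true, cond_false, star_one, one_mul, h1] at htt hft hff
  have htf : star (Φ x) = ∑ p, star (w p true) * w p false := by
    rw [hft, star_sum]
    exact Finset.sum_congr rfl fun p _ => by rw [star_mul, star_star]
  refine ⟨m, l, fun p => w p true - w p false * Φ x, ?_⟩
  have h2 : ∀ p, star (w p true - w p false * Φ x) * (w p true - w p false * Φ x) =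
      star (w p true) * w p true - (star (w p true) * w p false) * Φ x
        - star (Φ x) * (star (w p false) * w p true)
        + star (Φ x) * (star (w p false) * w p false) * Φ x := by
    intro p
    simp only [star_sub, star_mul, sub_mul, mul_sub, mul_assoc]
    abel
  simp only [h2, Finset.sum_add_distrib, Finset.sum_sub_distrib, ← Finset.sum_mul,
    ← Finset.mul_sum]
  rw [← htt, ← htf, ← hft, ← hff]
  simp

/-- Matrix coefficients `z ↦ (f ⊗ g) (y* Φ(z) y')` of product functionals are finite sums of
products of bounded functionals, hence bounded. -/
theorem exists_bound_algProd {φ : A →ₗ[ℂ] C} {ψ : B →ₗ[ℂ] D} (hφ : Continuous φ)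
    (hψ : Continuous ψ) (f : C →L[ℂ] ℂ) (g : D →L[ℂ] ℂ) (y y' : C ⊗[ℂ] D) :
    ∃ K : ℝ, ∀ z, ‖algProd f g (star y * (TensorProduct.map φ ψ z * y'))‖ ≤ K * ‖ofAlg k z‖ := by
  induction y using TensorProduct.induction_on with
  | zero => exact ⟨0, fun z => by simp⟩
  | add y₁ y₂ h₁ h₂ =>
    obtain ⟨K₁, h₁⟩ := h₁
    obtain ⟨K₂, h₂⟩ := h₂
    refine ⟨K₁ + K₂, fun z => ?_⟩
    rw [star_add, add_mul, map_add, add_mul]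
    exact (norm_add_le _ _).trans (add_le_add (h₁ z) (h₂ z))
  | tmul c d =>
    induction y' using TensorProduct.induction_on with
    | zero => exact ⟨0, fun z => by simp⟩
    | add y₁ y₂ h₁ h₂ =>
      obtain ⟨K₁, h₁⟩ := h₁
      obtain ⟨K₂, h₂⟩ := h₂
      refine ⟨K₁ + K₂, fun z => ?_⟩
      rw [mul_add, mul_add, map_add, add_mul]
      exact (norm_add_le _ _).trans (add_le_add (h₁ z) (h₂ z))
    | tmul c' d' =>
      let F : A →L[ℂ] ℂ := ⟨(f : C →ₗ[ℂ] ℂ) ∘ₗ LinearMap.mulLeft ℂ (star c) ∘ₗ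
        LinearMap.mulRight ℂ c' ∘ₗ φ, f.continuous.comp (continuous_const.mul
          (hφ.mul continuous_const))⟩
      let G : B →L[ℂ] ℂ := ⟨(g : D →ₗ[ℂ] ℂ) ∘ₗ LinearMap.mulLeft ℂ (star d) ∘ₗ
        LinearMap.mulRight ℂ d' ∘ₗ ψ, g.continuous.comp (continuous_const.mul
          (hψ.mul continuous_const))⟩
      obtain ⟨T, hT⟩ := exists_prod_functional (k := k) F G
      refine ⟨‖T‖, fun z => ?_⟩
      have h : algProd f g (star (c ⊗ₜ[ℂ] d) * (TensorProduct.map φ ψ z * c' ⊗ₜ[ℂ] d')) =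
          T (ofAlg k z) := by
        induction z using TensorProduct.induction_on with
        | zero => simp
        | tmul a b => simp [hT, F, G]
        | add z₁ z₂ h₁ h₂ => rw [map_add, map_add, map_add, add_mul, mul_add, map_add, h₁, h₂]
      rw [h]
      exact T.le_opNorm _

/-- Tensor products of unital completely positive maps are contractive for both C*-norms. -/
theorem norm_ofAlg_map_ucp_le {φ : A →ₗ[ℂ] C} {ψ : B →ₗ[ℂ] D} (hφ : IsUCP φ) (hψ : IsUCP ψ)
    (x : A ⊗[ℂ] B) : ‖ofAlg k (TensorProduct.map φ ψ x)‖ ≤ ‖ofAlg k x‖ := by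
  refine norm_ofAlg_le (norm_nonneg _) fun ω hω y => ?_
  have hpos := isPositiveFunctional_of_mem hω
  set Φ := TensorProduct.map φ ψ with hΦ
  have h1 : Φ 1 = 1 := by
    rw [Algebra.TensorProduct.one_def, hΦ, TensorProduct.map_tmul, hφ.map_one, hψ.map_one,
      Algebra.TensorProduct.one_def]
  set ω' : A ⊗[ℂ] B →ₗ[ℂ] ℂ := conjFunctional ω y ∘ₗ Φ with hω'
  have hω'pos : IsPositiveFunctional ω' := by
    intro z
    obtain ⟨m, l, w, hw⟩ := exists_gram_map hφ hψ fun _ : Unit => z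
    rw [hω', LinearMap.comp_apply, hΦ, hw () (), map_sum]
    exact Finset.sum_nonneg fun p _ => hpos.conjFunctional y (w p ())
  have hschwarz : (ω (star (Φ x * y) * (Φ x * y))).re ≤ (ω' (star x * x)).re := by
    obtain ⟨m, l, v, hv⟩ := exists_kadisonSchwarz hφ hψ x
    rw [hω', LinearMap.comp_apply, hΦ, hv, ← hΦ, map_add, conjFunctional_star_mul_self,
      Complex.add_re, map_sum, Complex.re_sum]
    exact le_add_of_nonneg_right
      (Finset.sum_nonneg fun p _ => (hpos.conjFunctional y).re_nonneg (v p))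
  have hone : (ω' 1).re = gnsVec ω y ^ 2 := by
    rw [hω', LinearMap.comp_apply, h1, conjFunctional_apply, one_mul, gnsVec_sq hpos]
  have hmain : (ω' (star x * x)).re ≤ ‖ofAlg k x‖ ^ 2 * (ω' 1).re := by
    cases k with
    | projective =>
      have h2 := gnsVec_mul_le_norm (k := .projective) (ω := ω') hω'pos x 1
      rw [mul_one] at h2
      have h3 := pow_le_pow_left₀ (gnsVec_nonneg _ _) h2 2
      rwa [mul_pow, gnsVec_sq hω'pos, gnsVec_sq hω'pos, star_one, one_mul] at h3
    | injective =>
      obtain ⟨f, g, hf, hg, rfl⟩ := hω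
      obtain ⟨K, hK⟩ := exists_bound_algProd (k := .injective) hφ.isPositiveMap.continuous
        hψ.isPositiveMap.continuous f g y y
      have h2 := hω'pos.apply_le_of_bound (p := fun z => ‖ofAlg .injective z‖)
        (fun z => norm_nonneg _) (fun z z' => by rw [map_mul]; exact norm_mul_le _ _) hK x
      rwa [map_mul (ofAlg _), map_star (ofAlg _), CStarRing.norm_star_mul_self, ← sq] at h2
  refine le_of_sq_le_sq ?_ (mul_nonneg (norm_nonneg _) (gnsVec_nonneg _ _))
  rw [mul_pow, gnsVec_sq hpos, ← hone]
  exact hschwarz.trans hmain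

/-- Unital completely positive maps have a tensor product, which is again unital and completely
positive. -/
theorem exists_tensorMap {φ : A →ₗ[ℂ] C} {ψ : B →ₗ[ℂ] D} (hφ : IsUCP φ) (hψ : IsUCP ψ) :
    ∃ F : CStarTensor k A B →L[ℂ] CStarTensor k C D,
      (∀ a b, F (tmul k a b) = tmul k (φ a) (ψ b)) ∧
        IsUCP (F : CStarTensor k A B →ₗ[ℂ] CStarTensor k C D) := by
  obtain ⟨F, hF, -⟩ := exists_extension (k := k)
    ((ofAlg k : C ⊗[ℂ] D →⋆ₐ[ℂ] _).toAlgHom.toLinearMap ∘ₗ TensorProduct.map φ ψ) 1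
    (fun x => (norm_ofAlg_map_ucp_le hφ hψ x).trans_eq (one_mul _).symm)
  have hF' : ∀ x, F (ofAlg k x) = ofAlg k (TensorProduct.map φ ψ x) := hF
  have htm : ∀ a b, F (tmul k a b) = tmul k (φ a) (ψ b) := fun a b => hF (a ⊗ₜ b)
  refine ⟨F, htm, ?_, fun n x => ?_⟩
  · rw [← tmul_one_one, ContinuousLinearMap.coe_coe, htm, hφ.map_one, hψ.map_one, tmul_one_one]
  have hd : DenseRange fun (y : Fin n → A ⊗[ℂ] B) i => (ofAlg k (y i) : CStarTensor k A B) :=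
    DenseRange.piMap fun _ => denseRange_ofAlg
  refine hd.induction_on (p := fun x => IsPSD fun i j =>
    (F : CStarTensor k A B →ₗ[ℂ] CStarTensor k C D) (star (x i) * x j)) x ?_ fun y => ?_
  · refine isClosed_isPSD.preimage
      (f := fun x : Fin n → CStarTensor k A B => fun i j => F (star (x i) * x j)) ?_
    refine continuous_pi fun i => continuous_pi fun j => F.continuous.comp ?_
    exact (CStarTensor.continuous_star.comp (continuous_apply i)).mul (continuous_apply j)
  · obtain ⟨m, l, w, hw⟩ := exists_gram_map hφ hψ y
    refine isPSD_of_gram (fun p i => ofAlg k (w p i)) fun i j => ?_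
    rw [ContinuousLinearMap.coe_coe, ← map_star, ← map_mul, hF', hw, map_sum]
    exact Finset.sum_congr rfl fun p _ => by rw [map_mul, map_star]

/-- Unital `*`-homomorphisms have a tensor product. -/
theorem exists_tensorHom (φ : A →⋆ₐ[ℂ] C) (ψ : B →⋆ₐ[ℂ] D) :
    ∃ F : CStarTensor k A B →⋆ₐ[ℂ] CStarTensor k C D, Continuous F ∧
      ∀ a b, F (tmul k a b) = tmul k (φ a) (ψ b) := by
  obtain ⟨F, hF, hU⟩ := exists_tensorMap (k := k) (IsUCP.of_starHom φ) (IsUCP.of_starHom ψ)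
  have hmul : ∀ x y, F (x * y) = F x * F y := by
    intro x y
    have h1 : ∀ a b y, F (tmul k a b * y) = F (tmul k a b) * F y := by
      intro a b y
      refine CStarTensor.hom_ext_apply (F := F.comp (ContinuousLinearMap.mul ℂ _ (tmul k a b)))
        (F' := (ContinuousLinearMap.mul ℂ _ (F (tmul k a b))).comp F) (fun a' b' => ?_) y
      simp [hF]
    refine CStarTensor.hom_ext_apply (F := F.comp ((ContinuousLinearMap.mul ℂ _).flip y))
      (F' := ((ContinuousLinearMap.mul ℂ _).flip (F y)).comp F) (fun a b => ?_) x
    simp [h1]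
  refine ⟨{ toFun := F, map_one' := hU.map_one, map_mul' := hmul, map_zero' := map_zero F,
            map_add' := map_add F, commutes' := fun r => ?_,
            map_star' := hU.isPositiveMap.map_star }, F.continuous, hF⟩
  rw [Algebra.algebraMap_eq_smul_one, map_smul, Algebra.algebraMap_eq_smul_one]
  exact congrArg (r • ·) hU.map_one

end TensorMaps

/-! ### Antilinear automorphisms -/

section Conj

variable {A : Type*} [CStarAlgebra A] {k : CStarTensorKind}

theorem continuous_of_isPositiveFunctional {f : A →ₗ[ℂ] ℂ} (hf : IsPositiveFunctional f) :
    Continuous f := by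
  let _ := CStarAlgebra.spectralOrder A
  let _ := CStarAlgebra.spectralOrderedRing A
  exact map_continuous (PositiveLinearMap.mk₀ f fun a ha => by
    obtain ⟨b, rfl⟩ := CStarAlgebra.nonneg_iff_eq_star_mul_self.1 ha
    exact hf b)

/-- The linear functional `x ↦ conj (ω (J x))`, for an antilinear map `J`. -/
noncomputable def conjComp {E F : Type*} [AddCommGroup E] [Module ℂ E] [AddCommGroup F] [Module ℂ F]
    (ω : F →ₗ[ℂ] ℂ) (J : E →ₗ⋆[ℂ] F) : E →ₗ[ℂ] ℂ where
  toFun x := conj (ω (J x))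
  map_add' x y := by simp
  map_smul' c x := by simp

/-- Antilinear involutive `*`-automorphisms conjugate states to states. -/
theorem exists_conj_state (s : A →ₗ⋆[ℂ] A) (hinv : ∀ a, s (s a) = a)
    (hmul : ∀ a b, s (a * b) = s a * s b) (hstar : ∀ a, s (star a) = star (s a)) {f : A →L[ℂ] ℂ}
    (hf : IsState f) : ∃ f' : A →L[ℂ] ℂ, IsState f' ∧ ∀ a, f' a = conj (f (s a)) := by
  have hs1 : s 1 = 1 := by
    have h := hmul (s 1) 1
    rw [mul_one, hinv, one_mul] at h
    exact h.symm
  have hp : IsPositiveFunctional (conjComp (f : A →ₗ[ℂ] ℂ) s) := by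
    intro a
    have := hf.nonneg (s a)
    rw [← hstar, ← hmul] at this
    exact star_nonneg_iff.2 this
  refine ⟨⟨_, continuous_of_isPositiveFunctional hp⟩, ⟨hp, ?_⟩, fun a => rfl⟩
  change conj (f (s 1)) = 1
  rw [hs1, hf.map_one, map_one]

/-- If `s` is an antilinear involutive `*`-automorphism, then `s ⊗ s` exists on C*-tensor
products. -/
theorem exists_conjTensor (s : A →ₗ⋆[ℂ] A) (hinv : ∀ a, s (s a) = a)
    (hmul : ∀ a b, s (a * b) = s a * s b) (hstar : ∀ a, s (star a) = star (s a)) :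
    ∃ F : CStarTensor k A A →L⋆[ℂ] CStarTensor k A A,
      ∀ a b, F (tmul k a b) = tmul k (s a) (s b) := by
  set J : A ⊗[ℂ] A →ₗ⋆[ℂ] A ⊗[ℂ] A := TensorProduct.map s s with hJdef
  have hJinv : ∀ x, J (J x) = x := by
    intro x
    induction x using TensorProduct.induction_on with
    | zero => simp
    | tmul a b => simp [J, hinv]
    | add x y hx hy => rw [map_add, map_add, hx, hy]
  have hJstar : ∀ x, J (star x) = star (J x) := by
    intro x
    induction x using TensorProduct.induction_on with
    | zero => simp
    | tmul a b => simp [J, hstar]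
    | add x y hx hy => rw [star_add, map_add, map_add, star_add, hx, hy]
  have hJmul : ∀ x y, J (x * y) = J x * J y := by
    intro x y
    induction x using TensorProduct.induction_on with
    | zero => simp
    | add x x' hx hx' => rw [add_mul, map_add, map_add, add_mul, hx, hx']
    | tmul a b =>
      induction y using TensorProduct.induction_on with
      | zero => simp
      | add x x' hx hx' => rw [mul_add, map_add, map_add, mul_add, hx, hx']
      | tmul a b => simp [J, hmul]
  have hstate := fun f hf => exists_conj_state s hinv hmul hstar (f := f) hf
  have hb := norm_ofAlg_map_le (k := k) (J := J) (fun x => ⟨J x, hJinv x⟩) hJmul fun ω hω => by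
    refine ⟨conjComp ω J, ?_, fun x => ?_⟩
    · cases k with
      | injective =>
        obtain ⟨f, g, hf, hg, rfl⟩ := hω
        obtain ⟨f', hf', hff'⟩ := hstate f hf
        obtain ⟨g', hg', hgg'⟩ := hstate g hg
        refine ⟨f', g', hf', hg', TensorProduct.ext' fun a b => ?_⟩
        rw [algProd_tmul, hff', hgg', ← map_mul]
        rfl
      | projective =>
        intro x
        have := hω (J x)
        rw [← hJstar, ← hJmul] at this
        exact star_nonneg_iff.2 this
    · simp only [gnsVec, ← hJstar, ← hJmul]
      rfl
  have hbound : ∀ x, ‖((ofAlg k : A ⊗[ℂ] A →⋆ₐ[ℂ] _).toAlgHom.toLinearMap ∘ₛₗ J) x‖ ≤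
      1 * ‖ofAlg k x‖ := fun x => (hb x).trans_eq (one_mul _).symm
  obtain ⟨F, hF, -⟩ := exists_extension (k := k) _ 1 hbound
  exact ⟨F, fun a b => hF (a ⊗ₜ b)⟩

end Conj

/-! ### Product states on the injective tensor product -/

section ProductStates

variable {A B D : Type*} [CStarAlgebra A] [CStarAlgebra B] [CStarAlgebra D] {k : CStarTensorKind}

theorem IsState.isPositiveFunctional {f : A →L[ℂ] ℂ} (hf : IsState f) :
    IsPositiveFunctional (f : A →ₗ[ℂ] ℂ) := hf.nonneg

theorem apply_ofAlg_eq_algProd {F : CStarTensor k A B →L[ℂ] ℂ} {f : A →L[ℂ] ℂ} {g : B →L[ℂ] ℂ}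
    (hF : ∀ a b, F (tmul k a b) = f a * g b) (x : A ⊗[ℂ] B) : F (ofAlg k x) = algProd f g x := by
  induction x using TensorProduct.induction_on with
  | zero => simp
  | tmul a b => exact hF a b
  | add x y hx hy => rw [map_add, map_add, map_add, hx, hy]

theorem isState_of_prod {F : CStarTensor k A B →L[ℂ] ℂ} {f : A →L[ℂ] ℂ} {g : B →L[ℂ] ℂ}
    (hf : IsState f) (hg : IsState g) (hF : ∀ a b, F (tmul k a b) = f a * g b) : IsState F := by
  refine ⟨fun x => ?_, by rw [← tmul_one_one, hF, hf.map_one, hg.map_one, mul_one]⟩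
  refine denseRange_ofAlg.induction_on (p := fun x => 0 ≤ F (star x * x)) x ?_ fun x => ?_
  · exact isClosed_Ici.preimage (F.continuous.comp (CStarTensor.continuous_star.mul continuous_id))
  · rw [← map_star, ← map_mul, apply_ofAlg_eq_algProd hF]
    exact isPositiveFunctional_algProd hf hg x

theorem exists_prod_state {f : A →L[ℂ] ℂ} {g : B →L[ℂ] ℂ} (hf : IsState f) (hg : IsState g) :
    ∃ F : CStarTensor k A B →L[ℂ] ℂ, IsState F ∧ ∀ a b, F (tmul k a b) = f a * g b := by
  obtain ⟨F, hF⟩ := exists_prod_functional (k := k) f g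
  exact ⟨F, isState_of_prod hf hg hF, hF⟩

/-- Slice maps by states are unital and completely positive. -/
theorem isUCP_slice_left {f : A →L[ℂ] ℂ} (hf : IsState f) {S : CStarTensor k A B →L[ℂ] B}
    (hS : ∀ a b, S (tmul k a b) = f a • b) : IsUCP (S : CStarTensor k A B →ₗ[ℂ] B) := by
  let L : ℂ ⊗[ℂ] B ≃ₐ[ℂ] B := Algebra.TensorProduct.lid ℂ B
  have hLstar : ∀ x, L (star x) = star (L x) := by
    intro x
    induction x using TensorProduct.induction_on with
    | zero => simp
    | tmul a b => simp [L]
    | add x y hx hy => rw [star_add, map_add, map_add, star_add, hx, hy]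
  have hSL : ∀ x, S (ofAlg k x) =
      L (TensorProduct.map (f : A →ₗ[ℂ] ℂ) (LinearMap.id : B →ₗ[ℂ] B) x) := by
    intro x
    induction x using TensorProduct.induction_on with
    | zero => simp
    | tmul a b => simp [L, hS]
    | add x y hx hy => rw [map_add, map_add, map_add, map_add, hx, hy]
  refine ⟨?_, fun n x => ?_⟩
  · rw [← tmul_one_one, ContinuousLinearMap.coe_coe, hS, hf.map_one, one_smul]
  have hd : DenseRange fun (y : Fin n → A ⊗[ℂ] B) i => (ofAlg k (y i) : CStarTensor k A B) :=
    DenseRange.piMap fun _ => denseRange_ofAlg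
  refine hd.induction_on (p := fun x => IsPSD fun i j =>
    (S : CStarTensor k A B →ₗ[ℂ] B) (star (x i) * x j)) x ?_ fun y => ?_
  · refine isClosed_isPSD.preimage
      (f := fun x : Fin n → CStarTensor k A B => fun i j => S (star (x i) * x j)) ?_
    refine continuous_pi fun i => continuous_pi fun j => S.continuous.comp ?_
    exact (CStarTensor.continuous_star.comp (continuous_apply i)).mul (continuous_apply j)
  · obtain ⟨m, l, w, hw⟩ := exists_gram_map hf.isUCP (isUCP_id (A := B)) y
    refine isPSD_of_gram (fun p i => L (w p i)) fun i j => ?_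
    rw [ContinuousLinearMap.coe_coe, ← map_star, ← map_mul, hSL, hw, map_sum]
    exact Finset.sum_congr rfl fun p _ => by rw [map_mul, hLstar]

theorem gnsVec_mul_le_of_isState {f : A →L[ℂ] ℂ} (hf : IsState f) (x y : A) :
    gnsVec (f : A →ₗ[ℂ] ℂ) (x * y) ≤ ‖x‖ * gnsVec (f : A →ₗ[ℂ] ℂ) y := by
  obtain ⟨c, hc⟩ := exists_defect x
  exact gnsVec_mul_le_of_defect hf.isPositiveFunctional (norm_nonneg x) hc y

/-- The state `a ↦ f (c* a c) / f (c* c)`. -/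
theorem IsState.exists_normalize {f : A →L[ℂ] ℂ} (hf : IsState f) {c : A}
    (hc : f (star c * c) ≠ 0) : ∃ f' : A →L[ℂ] ℂ, IsState f' ∧
      ∀ a, f (star c * (a * c)) = f (star c * c) * f' a := by
  have h0 := hf.nonneg c
  let f₁ : A →L[ℂ] ℂ := ⟨conjFunctional (f : A →ₗ[ℂ] ℂ) c,
    f.continuous.comp (continuous_const.mul (continuous_id.mul continuous_const))⟩
  refine ⟨(f (star c * c))⁻¹ • f₁, ⟨fun a => ?_, ?_⟩, fun a => ?_⟩
  · have h1 : 0 ≤ f₁ (star a * a) := hf.isPositiveFunctional.conjFunctional c a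
    have h2 : 0 ≤ (f (star c * c))⁻¹ := inv_nonneg.2 h0
    exact mul_nonneg h2 h1
  · change (f (star c * c))⁻¹ * f (star c * (1 * c)) = 1
    rw [one_mul, inv_mul_cancel₀ hc]
  · change _ = f (star c * c) * ((f (star c * c))⁻¹ * f (star c * (a * c)))
    rw [mul_inv_cancel_left₀ hc]

/-- Product states are faithful on the injective tensor product. As the functional
`z ↦ F (y* z y)` for an elementary tensor `y` is a multiple of a product state, `e` annihilates
all vectors of the GNS spaces of product states, and these spaces define the norm. -/
theorem eq_zero_of_forall_prod_state {e : CStarTensor .injective A B}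
    (h : ∀ (f : A →L[ℂ] ℂ) (g : B →L[ℂ] ℂ), IsState f → IsState g →
      ∀ F : CStarTensor .injective A B →L[ℂ] ℂ, (∀ a b, F (tmul .injective a b) = f a * g b) →
        F (star e * e) = 0) : e = 0 := by
  have hvec : ∀ (f : A →L[ℂ] ℂ) (g : B →L[ℂ] ℂ), IsState f → IsState g →
      ∀ F : CStarTensor .injective A B →L[ℂ] ℂ, (∀ a b, F (tmul .injective a b) = f a * g b) →
      ∀ y, gnsVec (F : CStarTensor .injective A B →ₗ[ℂ] ℂ) (e * ofAlg .injective y) = 0 := by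
    intro f g hf hg F hF y
    have hFs := isState_of_prod hf hg hF
    induction y using TensorProduct.induction_on with
    | zero => simp [gnsVec]
    | add y y' hy hy' =>
      refine le_antisymm ?_ (gnsVec_nonneg _ _)
      rw [map_add, mul_add]
      refine (gnsVec_add hFs.isPositiveFunctional _ _).trans ?_
      rw [hy, hy', add_zero]
    | tmul c d =>
      by_cases hcd : f (star c * c) = 0 ∨ g (star d * d) = 0
      · refine le_antisymm ((gnsVec_mul_le_of_isState hFs _ _).trans_eq ?_) (gnsVec_nonneg _ _)
        have : F (star (tmul .injective c d) * tmul .injective c d) = 0 := by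
          rw [star_tmul, tmul_mul_tmul, hF]
          exact mul_eq_zero.2 hcd
        rw [ofAlg_tmul, gnsVec, ContinuousLinearMap.coe_coe, this, Complex.zero_re, Real.sqrt_zero,
          mul_zero]
      · rw [not_or] at hcd
        obtain ⟨f', hf', hff'⟩ := hf.exists_normalize hcd.1
        obtain ⟨g', hg', hgg'⟩ := hg.exists_normalize hcd.2
        obtain ⟨F', hF'⟩ := exists_prod_functional (k := .injective) f' g'
        let F₁ : CStarTensor .injective A B →L[ℂ] ℂ :=
          ⟨conjFunctional (F : CStarTensor .injective A B →ₗ[ℂ] ℂ) (tmul .injective c d),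
            F.continuous.comp (continuous_const.mul (continuous_id.mul continuous_const))⟩
        have h1 := CStarTensor.hom_ext_apply (F := F₁)
          (F' := (f (star c * c) * g (star d * d)) • F') (fun a b => by
            change F (star (tmul .injective c d) * (tmul .injective a b * tmul .injective c d)) =
              (f (star c * c) * g (star d * d)) * F' (tmul .injective a b)
            rw [star_tmul, tmul_mul_tmul, tmul_mul_tmul, hF, hff', hgg', hF']
            ring) (star e * e)
        have h2 : F₁ (star e * e) = 0 := by
          rw [h1]
          change _ * F' (star e * e) = 0
          rw [h f' g' hf' hg' F' hF', mul_zero]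
        have h3 := conjFunctional_star_mul_self (F : CStarTensor .injective A B →ₗ[ℂ] ℂ)
          (tmul .injective c d) e
        rw [gnsVec, ofAlg_tmul, ← h3]
        change √((F₁ (star e * e)).re) = 0
        simp [h2]
  refine norm_le_zero_iff.1 (le_of_forall_pos_le_add fun ε hε => ?_)
  obtain ⟨x, hx⟩ := denseRange_ofAlg.exists_dist_lt e (half_pos hε)
  rw [dist_eq_norm] at hx
  have h1 : ‖ofAlg .injective x‖ ≤ ε / 2 := by
    refine norm_ofAlg_le (half_pos hε).le ?_
    rintro ω ⟨f, g, hf, hg, rfl⟩ y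
    obtain ⟨F, hF⟩ := exists_prod_functional (k := .injective) f g
    have hFs := isState_of_prod hf hg hF
    have hvF : ∀ z, gnsVec (algProd f g) z =
        gnsVec (F : CStarTensor .injective A B →ₗ[ℂ] ℂ) (ofAlg .injective z) := by
      intro z
      rw [gnsVec, gnsVec, ← apply_ofAlg_eq_algProd hF, map_mul, map_star]
      rfl
    rw [hvF, hvF, map_mul]
    have h2 : ofAlg .injective x * ofAlg .injective y =
        (ofAlg .injective x - e) * ofAlg .injective y + e * ofAlg .injective y := by
      rw [sub_mul, sub_add_cancel]
    rw [h2]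
    refine (gnsVec_add hFs.isPositiveFunctional _ _).trans ?_
    rw [hvec f g hf hg F hF, add_zero]
    refine (gnsVec_mul_le_of_isState hFs _ _).trans ?_
    rw [norm_sub_rev]
    exact mul_le_mul_of_nonneg_right hx.le (gnsVec_nonneg _ _)
  calc ‖e‖ ≤ ‖e - ofAlg .injective x‖ + ‖ofAlg .injective x‖ := by
        simpa using norm_add_le (e - ofAlg .injective x) (ofAlg .injective x)
    _ ≤ 0 + ε := by linarith

end ProductStates

/-! ### Faithful families of states -/

section Norming

variable {T : Type*} [CStarAlgebra T]

/-- A faithful family `W` of positive functionals determines the norm: if `s = N² - t* t` has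
negative part `s₋`, then `ω (s₋ s s₋) = -ω (s₋³)` is nonnegative for `ω ∈ W`, whence `s₋ = 0`. -/
theorem norm_le_of_faithful {W : Set (T →L[ℂ] ℂ)} (hW : ∀ ω ∈ W, IsState ω)
    (hf : ∀ s, (∀ ω ∈ W, ω (star s * s) = 0) → s = 0) {t : T} {N : ℝ} (hN : 0 ≤ N)
    (h : ∀ ω ∈ W, ∀ v, (ω (star (t * v) * (t * v))).re ≤ N ^ 2 * (ω (star v * v)).re) :
    ‖t‖ ≤ N := by
  let _ := CStarAlgebra.spectralOrder T
  let _ := CStarAlgebra.spectralOrderedRing T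
  set s : T := ((N ^ 2 : ℝ) : ℂ) • (1 : T) - star t * t with hs
  have hsa : IsSelfAdjoint s := by
    rw [IsSelfAdjoint, hs, star_sub, star_smul, star_one, star_mul, star_star]
    simp
  obtain ⟨v, S, hv, hvs, h0⟩ := exists_negPart_sandwich hsa
  have hSv : S * v = 0 := by
    refine hf _ fun ω hω => ?_
    have h1 := h ω hω v
    have h2 : (((N ^ 2 : ℝ) : ℂ) • (star v * v)) - star (t * v) * (t * v) =
        -(star (S * v) * (S * v)) := by
      rw [← hvs, hs, hv]
      simp only [star_mul, hv, mul_sub, sub_mul, mul_smul_comm, smul_mul_assoc, mul_one, mul_assoc]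
    have h3 := congrArg (fun z => (ω z).re) h2
    simp only [map_sub, map_neg, map_smul, smul_eq_mul, Complex.sub_re, Complex.neg_re,
      Complex.re_ofReal_mul] at h3
    have h4 := (hW ω hω).nonneg (S * v)
    rw [Complex.le_def] at h4
    refine Complex.ext (le_antisymm (by rw [Complex.zero_re]; linarith) h4.1) h4.2.symm
  have hle := sub_nonneg.1 (h0 hSv)
  have h5 := CStarAlgebra.norm_le_norm_of_nonneg_of_le (star_mul_self_nonneg t) hle
  rw [CStarRing.norm_star_mul_self, norm_smul, Complex.norm_real,
    Real.norm_of_nonneg (sq_nonneg N)] at h5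
  have h6 : ‖(1 : T)‖ ≤ 1 := by
    rcases subsingleton_or_nontrivial T with hA | hA
    · simp [Subsingleton.elim (1 : T) 0]
    · rw [CStarRing.norm_one]
  refine le_of_sq_le_sq ?_ hN
  rw [sq]
  exact h5.trans (mul_le_of_le_one_right (sq_nonneg N) h6)

end Norming

/-! ### Associativity of the tensor product -/

section Assoc

variable {A B C : Type*} [CStarAlgebra A] [CStarAlgebra B] [CStarAlgebra C] {k : CStarTensorKind}

/-- The embedding `a ↦ a ⊗ 1` of the left leg. -/
noncomputable def inclLeft : A →⋆ₐ[ℂ] CStarTensor k A B where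
  toAlgHom := ((ofAlg k : A ⊗[ℂ] B →⋆ₐ[ℂ] _).toAlgHom).comp Algebra.TensorProduct.includeLeft
  map_star' a := by
    change tmul k (star a) 1 = star (tmul k a 1)
    simp

/-- The embedding `b ↦ 1 ⊗ b` of the right leg. -/
noncomputable def inclRight : B →⋆ₐ[ℂ] CStarTensor k A B where
  toAlgHom := ((ofAlg k : A ⊗[ℂ] B →⋆ₐ[ℂ] _).toAlgHom).comp Algebra.TensorProduct.includeRight
  map_star' a := by
    change tmul k 1 (star a) = star (tmul k 1 a)
    simp

@[simp]
theorem inclLeft_apply (a : A) : (inclLeft a : CStarTensor k A B) = tmul k a 1 := rfl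

@[simp]
theorem inclRight_apply (b : B) : (inclRight b : CStarTensor k A B) = tmul k 1 b := rfl

/-- The associator on `(A ⊗ B) ⊙ C`, with `⊙` the algebraic tensor product, as the product of the
commuting `*`-homomorphisms `a ⊗ b ↦ a ⊗ (b ⊗ 1)` and `c ↦ 1 ⊗ (1 ⊗ c)`. -/
theorem exists_algAssoc :
    ∃ α : CStarTensor k A B ⊗[ℂ] C →ₐ[ℂ] CStarTensor k A (CStarTensor k B C),
      (∀ x, α (star x) = star (α x)) ∧ (∀ c, Continuous fun x => α (x ⊗ₜ c)) ∧
      (∀ a b c, α (tmul k a b ⊗ₜ c) = tmul k a (tmul k b c)) ∧ DenseRange α := by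
  obtain ⟨j, hjc, hj⟩ := exists_tensorHom (k := k) (StarAlgHom.id ℂ A)
    (inclLeft : B →⋆ₐ[ℂ] CStarTensor k B C)
  let r : C →⋆ₐ[ℂ] CStarTensor k A (CStarTensor k B C) := inclRight.comp inclRight
  have hcomm : ∀ x c, j x * r c = r c * j x := by
    intro x c
    let J : CStarTensor k A B →L[ℂ] CStarTensor k A (CStarTensor k B C) :=
      ⟨j.toAlgHom.toLinearMap, hjc⟩
    refine CStarTensor.hom_ext_apply (F := ((ContinuousLinearMap.mul ℂ _).flip (r c)).comp J)
      (F' := ((ContinuousLinearMap.mul ℂ _) (r c)).comp J) (fun a b => ?_) x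
    change j (tmul k a b) * r c = r c * j (tmul k a b)
    simp [hj, r]
  let α : CStarTensor k A B ⊗[ℂ] C →ₐ[ℂ] CStarTensor k A (CStarTensor k B C) :=
    Algebra.TensorProduct.lift j.toAlgHom r.toAlgHom hcomm
  have hα : ∀ x c, α (x ⊗ₜ c) = j x * r c :=
    fun x c => Algebra.TensorProduct.lift_tmul _ _ _ _ _
  have hα3 : ∀ a b c, α (tmul k a b ⊗ₜ c) = tmul k a (tmul k b c) := fun a b c => by
    simp [hα, hj, r]
  refine ⟨α, fun x => ?_, fun c => ?_, hα3, ?_⟩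
  · induction x using TensorProduct.induction_on with
    | zero => simp
    | tmul x c =>
      rw [TensorProduct.star_tmul, hα, hα, map_star, map_star, star_mul]
      rw [← map_star, ← map_star, hcomm]
    | add x y hx hy => rw [star_add, map_add, map_add, star_add, hx, hy]
  · simp only [hα]
    exact hjc.mul continuous_const
  · have hsub : ∀ a (d : CStarTensor k B C), tmul k a d ∈ closure (Set.range α) := by
      intro a d
      have hc : Continuous fun d : CStarTensor k B C => tmul k a d := by
        have h : (fun d : CStarTensor k B C => tmul k a d) =
            fun d => tmul k a 1 * (inclRight d : CStarTensor k A (CStarTensor k B C)) := by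
          funext d; simp
        rw [h]
        exact continuous_const.mul (IsUCP.of_starHom inclRight).isPositiveMap.continuous
      refine denseRange_ofAlg.induction_on (p := fun d => tmul k a d ∈ closure (Set.range α)) d
        (isClosed_closure.preimage hc) fun y => subset_closure ?_
      induction y using TensorProduct.induction_on with
      | zero => exact ⟨0, by simp [← ofAlg_tmul]⟩
      | tmul b c => exact ⟨_, hα3 a b c⟩
      | add x y hx hy =>
        obtain ⟨x', hx'⟩ := hx
        obtain ⟨y', hy'⟩ := hy
        exact ⟨x' + y', by rw [map_add, hx', hy', map_add, tmul_add]⟩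
    have hcl : closure (Set.range α) = (α.range.toSubmodule.topologicalClosure : Set _) := rfl
    intro t
    rw [hcl] at hsub ⊢
    refine denseRange_ofAlg.induction_on
      (p := fun t => t ∈ α.range.toSubmodule.topologicalClosure) t
      (Submodule.isClosed_topologicalClosure _) fun y => ?_
    induction y using TensorProduct.induction_on with
    | zero => rw [map_zero]; exact Submodule.zero_mem _
    | tmul a d => exact hsub a d
    | add x y hx hy => rw [map_add]; exact Submodule.add_mem _ hx hy

/-- The associator exists on C*-tensor products. For the injective one, the triple products of
states are faithful on `A ⊗ (B ⊗ C)`, and they pull back to product functionals on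
`(A ⊗ B) ⊗ C`. -/
theorem exists_assoc :
    ∃ F : CStarTensor k (CStarTensor k A B) C →L[ℂ] CStarTensor k A (CStarTensor k B C),
      ∀ a b c, F (tmul k (tmul k a b) c) = tmul k a (tmul k b c) := by
  obtain ⟨α, hstar, hcont, hα, hdense⟩ := exists_algAssoc (k := k) (A := A) (B := B) (C := C)
  have hb : ∀ x, ‖α x‖ ≤ 1 * ‖ofAlg k x‖ := by
    intro x
    rw [one_mul]
    cases k with
    | projective =>
      rcases subsingleton_or_nontrivial (CStarTensor .projective A (CStarTensor .projective B C))
        with hT | hT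
      · rw [Subsingleton.elim (α x) 0, norm_zero]; exact norm_nonneg _
      obtain ⟨ω, hω, hx⟩ := exists_isState_apply (α x)
      let ω' := (ω : _ →ₗ[ℂ] ℂ) ∘ₗ α.toLinearMap
      have hω' : ∀ z, ω' (star z * z) = ω (star (α z) * α z) := fun z => by
        rw [← hstar, ← map_mul]; rfl
      have h1 : IsPositiveFunctional ω' := fun z => by rw [hω']; exact hω.nonneg _
      have h2 := gnsVec_mul_le_norm (k := .projective) (ω := ω') h1 x 1
      have h3 : gnsVec ω' 1 = 1 := by
        rw [gnsVec, hω', map_one, star_one, one_mul, hω.map_one]; simp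
      rw [h3, mul_one, mul_one, gnsVec, hω', hx, Complex.ofReal_re,
        Real.sqrt_sq (norm_nonneg _)] at h2
      exact h2
    | injective =>
      let W : Set (CStarTensor .injective A (CStarTensor .injective B C) →L[ℂ] ℂ) :=
        {ω | ∃ (f : A →L[ℂ] ℂ) (g : B →L[ℂ] ℂ) (h : C →L[ℂ] ℂ)
          (q : CStarTensor .injective B C →L[ℂ] ℂ), IsState f ∧ IsState g ∧ IsState h ∧
          (∀ b c, q (tmul .injective b c) = g b * h c) ∧
          ∀ a d, ω (tmul .injective a d) = f a * q d}
      refine norm_le_of_faithful (W := W) ?_ ?_ (norm_nonneg _) ?_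
      · rintro ω ⟨f, g, h, q, hf, hg, hh, hq, hω⟩
        exact isState_of_prod hf (isState_of_prod hg hh hq) hω
      · intro s hs
        refine eq_zero_of_forall_prod_state fun f p hf hp F hF => ?_
        obtain ⟨S, hS⟩ := exists_slice_left (k := .injective) (B := CStarTensor .injective B C) f
        obtain ⟨e, he⟩ := (isUCP_slice_left hf hS).exists_star_mul_self s
        have hFS : ∀ (p' : CStarTensor .injective B C →L[ℂ] ℂ)
            (F' : CStarTensor .injective A (CStarTensor .injective B C) →L[ℂ] ℂ),
            (∀ a d, F' (tmul .injective a d) = f a * p' d) → ∀ t, F' t = p' (S t) := by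
          intro p' F' hF' t
          exact CStarTensor.hom_ext_apply (F := F') (F' := p'.comp S)
            (fun a d => by simp [hF', hS]) t
        have he0 : e = 0 := by
          refine eq_zero_of_forall_prod_state fun g h hg hh q hq => ?_
          obtain ⟨F', hF'⟩ := exists_prod_functional (k := .injective) f q
          rw [← he]
          exact (hFS q F' hF' _).symm.trans (hs F' ⟨f, g, h, q, hf, hg, hh, hq, hF'⟩)
        rw [hFS p F hF]
        exact (congrArg p he).trans (by simp [he0])
      · rintro ω ⟨f, g, h, q, hf, hg, hh, hq, hω⟩ v
        have hωs := isState_of_prod hf (isState_of_prod hg hh hq) hω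
        obtain ⟨p, hp, hpp⟩ := exists_prod_state (k := .injective) hf hg
        have hpull : ∀ z, ω (α z) = algProd p h z := by
          intro z
          induction z using TensorProduct.induction_on with
          | zero => simp
          | tmul x c =>
            let R : CStarTensor .injective A B →L[ℂ] ℂ :=
              ⟨(ω : _ →ₗ[ℂ] ℂ) ∘ₗ α.toLinearMap ∘ₗ
                (TensorProduct.mk ℂ (CStarTensor .injective A B) C).flip c,
                ω.continuous.comp (hcont c)⟩
            have := CStarTensor.hom_ext_apply (F := R) (F' := h c • p) (fun a b => by
              change ω (α (tmul .injective a b ⊗ₜ c)) = h c * p (tmul .injective a b)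
              rw [hα, hω, hq, hpp]; ring) x
            exact this.trans (mul_comm _ _)
          | add x y hx hy => rw [map_add, map_add, map_add, hx, hy]
        refine hdense.induction_on (p := fun v => (ω (star (α x * v) * (α x * v))).re ≤
          ‖ofAlg .injective x‖ ^ 2 * (ω (star v * v)).re) v ?_ fun z => ?_
        · have hst := CStarTensor.continuous_star (k := .injective) (A := A)
            (B := CStarTensor .injective B C)
          have hm : Continuous fun v => α x * v := continuous_const.mul continuous_id
          exact isClosed_le
            (Complex.continuous_re.comp (ω.continuous.comp ((hst.comp hm).mul hm)))
            (continuous_const.mul (Complex.continuous_re.comp (ω.continuous.comp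
              (hst.mul continuous_id))))
        · have hpos := isPositiveFunctional_algProd hp hh
          rw [← map_mul, ← hstar, ← map_mul, ← hstar, ← map_mul, hpull, hpull, ← gnsVec_sq hpos,
            ← gnsVec_sq hpos, ← mul_pow]
          exact pow_le_pow_left₀ (gnsVec_nonneg _ _)
            (gnsVec_mul_le_norm (algProd_mem_testFunctionals hp hh) x z) 2
  obtain ⟨F, hF, -⟩ := exists_extension (k := k) α.toLinearMap 1 hb
  exact ⟨F, fun a b c => (hF _).trans (hα a b c)⟩

end Assoc

/-! ### Complex one-parameter groups -/

section ComplexExtension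

variable {X Y : Type*} [NormedRing X] [NormedAlgebra ℂ X] [NormedRing Y] [NormedAlgebra ℂ Y]

/-- Entire functions which agree on the real line are equal. -/
theorem entire_eq_of_real [CompleteSpace X] {f g : ℂ → X} (hf : Differentiable ℂ f)
    (hg : Differentiable ℂ g) (h : ∀ t : ℝ, f t = g t) : f = g := by
  refine AnalyticOnNhd.eq_of_frequently_eq (z₀ := 0) (fun z _ => hf.analyticAt z)
    (fun z _ => hg.analyticAt z) ?_
  have h1 : Filter.Tendsto (fun n : ℕ => ((1 / ((n : ℝ) + 1) : ℝ) : ℂ)) Filter.atTop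
      (nhdsWithin 0 {0}ᶜ) := by
    refine tendsto_nhdsWithin_iff.2 ⟨?_, Filter.Eventually.of_forall fun n => ?_⟩
    · have := (Complex.continuous_ofReal.tendsto 0).comp tendsto_one_div_add_atTop_nhds_zero_nat
      rwa [Complex.ofReal_zero] at this
    · simp only [Set.mem_compl_iff, Set.mem_singleton_iff, Complex.ofReal_eq_zero]
      positivity
  exact h1.frequently (Filter.Frequently.of_forall fun n => h _)

variable {τ : ℝ → X → X} {D : Subalgebra ℂ X} {τc : ℂ → D ≃ₐ[ℂ] D}

theorem IsComplexExtension.map_zero (h : IsComplexExtension τ D τc) (x : D) : τc 0 x = x := by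
  have := h.map_add 0 0 x
  rw [add_zero] at this
  exact ((τc 0).injective this).symm

/-- A bounded map commuting with the real one-parameter family on `D` commutes with its complex
extension. -/
theorem IsComplexExtension.commute [CompleteSpace X] (h : IsComplexExtension τ D τc) (R : X →L[ℂ] X)
    (hR : ∀ x ∈ D, R x ∈ D) (hτ : ∀ t, ∀ x ∈ D, R (τ t x) = τ t (R x)) (z : ℂ) (x : D) :
    R (τc z x) = τc z ⟨R x, hR x x.2⟩ := by
  have := entire_eq_of_real (f := fun z => R (τc z x)) (g := fun z => (τc z ⟨R x, hR x x.2⟩ : X))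
    (R.differentiable.comp (h.entire x)) (h.entire _) fun t => by
      rw [h.map_real, h.map_real, hτ t x x.2]
  exact congrFun this z

/-- Complex extensions restrict along a closed subalgebra `j : Y → X` with a bounded projection `Q`
commuting with the one-parameter family. -/
theorem IsComplexExtension.exists_restrict [CompleteSpace X] (h : IsComplexExtension τ D τc)
    {j : Y →ₐ[ℂ] X} (hj : Continuous j) {Q : X →L[ℂ] Y} (hQ : ∀ y, Q (j y) = y)
    (hD : ∀ x ∈ D, j (Q x) ∈ D) (hτ : ∀ t, ∀ x ∈ D, j (Q (τ t x)) = τ t (j (Q x)))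
    {τ' : ℝ → Y → Y} (hτ' : ∀ t y, j (τ' t y) = τ t (j y)) :
    ∃ τc' : ℂ → D.comap j ≃ₐ[ℂ] D.comap j, IsComplexExtension τ' (D.comap j) τc' ∧
      ∀ z (y : D.comap j), j (τc' z y : Y) = τc z ⟨j y, y.2⟩ := by
  have hinj : Function.Injective j := Function.LeftInverse.injective hQ
  have hjQ : ∀ z (y : D.comap j), j (Q (τc z ⟨j y, y.2⟩)) = τc z ⟨j y, y.2⟩ := by
    intro z y
    have := h.commute ((⟨j.toLinearMap, hj⟩ : Y →L[ℂ] X).comp Q) hD hτ z ⟨j y, y.2⟩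
    refine this.trans ?_
    congr 2
    exact Subtype.ext (congrArg j (hQ y))
  let jD : D.comap j →ₐ[ℂ] D := (j.comp (D.comap j).val).codRestrict D fun y => y.2
  let f : ℂ → D.comap j → D.comap j := fun z y =>
    ⟨Q (τc z (jD y)), (Subalgebra.mem_comap _ _ _).2 (by
      rw [show j (Q (τc z (jD y))) = _ from hjQ z y]
      exact (τc z _).2)⟩
  have hf : ∀ z y, j (f z y : Y) = τc z (jD y) := hjQ
  have hext : ∀ y y' : D.comap j, j (y : Y) = j (y' : Y) → y = y' :=
    fun y y' hyy => Subtype.ext (hinj hyy)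
  have hff : ∀ z w y, f (z + w) y = f z (f w y) := fun z w y => hext _ _ (by
    rw [hf, hf, h.map_add]
    congr 2
    exact Subtype.ext (hf w y).symm)
  have hf0 : ∀ y, f 0 y = y := fun y => hext _ _ (by rw [hf, h.map_zero]; rfl)
  let e : ℂ → D.comap j ≃ₐ[ℂ] D.comap j := fun z =>
    { toFun := f z
      invFun := f (-z)
      left_inv := fun y => by rw [← hff, neg_add_cancel, hf0]
      right_inv := fun y => by rw [← hff, add_neg_cancel, hf0]
      map_mul' := fun y y' => hext _ _ (by
        rw [hf, map_mul jD, map_mul (τc z), Subalgebra.coe_mul, Subalgebra.coe_mul, map_mul j,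
          hf, hf])
      map_add' := fun y y' => hext _ _ (by
        rw [hf, _root_.map_add jD, _root_.map_add (τc z), Subalgebra.coe_add, Subalgebra.coe_add,
          _root_.map_add j,
          hf, hf])
      commutes' := fun r => hext _ _ (by
        rw [hf, AlgHom.commutes jD, AlgEquiv.commutes]
        exact (AlgHom.commutes j r).symm) }
  refine ⟨e, ⟨fun z w y => hff z w y, fun t y => ?_, fun y => ?_⟩, hf⟩
  · exact hinj ((hf t y).trans ((h.map_real t _).trans (hτ' t y).symm))
  · exact Q.differentiable.comp (h.entire ⟨j y, y.2⟩)

/-- Dense subalgebras invariant under a bounded projection restrict to dense subalgebras. -/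
theorem dense_comap (hd : Dense (D : Set X)) {j : Y →ₐ[ℂ] X} {Q : X →L[ℂ] Y}
    (hQ : ∀ y, Q (j y) = y) (hD : ∀ x ∈ D, j (Q x) ∈ D) : Dense (D.comap j : Set Y) := by
  have hs : Function.Surjective Q := fun y => ⟨j y, hQ y⟩
  refine (hs.denseRange.dense_image Q.continuous hd).mono ?_
  rintro _ ⟨x, hx, rfl⟩
  exact hD x hx

end ComplexExtension

/-! ### Identification of the maps defined by their values on elementary tensors -/

section TensorTools

variable {A B C : Type*} [CStarAlgebra A] [CStarAlgebra B] [CStarAlgebra C] {k : CStarTensorKind}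

theorem continuous_tmul_left (b : B) : Continuous fun a : A => tmul k a b := by
  have h : (fun a : A => tmul k a b) =
      fun a => (inclLeft a : CStarTensor k A B) * tmul k 1 b := by
    funext a; simp
  rw [h]
  exact (IsUCP.of_starHom inclLeft).isPositiveMap.continuous.mul continuous_const

/-- The map `a ↦ a ⊗ b`. -/
noncomputable def tmulCLM (b : B) : A →L[ℂ] CStarTensor k A B where
  toFun a := tmul k a b
  map_add' a a' := add_tmul a a' b
  map_smul' c a := smul_tmul c a b
  cont := continuous_tmul_left b

theorem CStarTensor.hom_ext_apply₃ {E : Type*} [NormedAddCommGroup E] [NormedSpace ℂ E]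
    {F F' : CStarTensor k (CStarTensor k A B) C →L[ℂ] E}
    (h : ∀ a b c, F (tmul k (tmul k a b) c) = F' (tmul k (tmul k a b) c))
    (x : CStarTensor k (CStarTensor k A B) C) : F x = F' x :=
  CStarTensor.hom_ext_apply (fun y c => CStarTensor.hom_ext_apply (F := F.comp (tmulCLM c))
    (F' := F'.comp (tmulCLM c)) (fun a b => h a b c) y) x

theorem tensorAssoc_eq_clm {F : CStarTensor k (CStarTensor k A B) C →L[ℂ]
      CStarTensor k A (CStarTensor k B C)}
    (hF : ∀ a b c, F (tmul k (tmul k a b) c) = tmul k a (tmul k b c)) :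
    (tensorAssoc : CStarTensor k (CStarTensor k A B) C → _) = F := by
  refine tlift_eq_clm F fun x c => ?_
  rw [tlift_eq_clm (F.comp (tmulCLM c)) fun a b => hF a b c]
  rfl

theorem tensorFlip_eq_clm {F : CStarTensor k A B →L[ℂ] CStarTensor k B A}
    (hF : ∀ a b, F (tmul k a b) = tmul k b a) : tensorFlip = F := tlift_eq_clm F hF

/-- Antilinear involutive `*`-automorphisms are contractive. -/
theorem continuous_of_conj (s : A →ₗ⋆[ℂ] A) (hinv : ∀ a, s (s a) = a)
    (hmul : ∀ a b, s (a * b) = s a * s b) (hstar : ∀ a, s (star a) = star (s a)) :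
    Continuous s := by
  rcases subsingleton_or_nontrivial A with hA | hA
  · exact continuous_of_discreteTopology
  refine (s.mkContinuous 1 fun a => ?_).continuous
  obtain ⟨f, hf, hfa⟩ := exists_isState_apply (s a)
  obtain ⟨f', hf', hff'⟩ := exists_conj_state s hinv hmul hstar hf
  have h1 := gnsVec_mul_le_of_isState hf' a 1
  have h2 : f' (star a * a) = ((‖s a‖ ^ 2 : ℝ) : ℂ) := by
    rw [hff', hmul, hstar, hfa, Complex.conj_ofReal]
  have h3 : gnsVec (f' : A →ₗ[ℂ] ℂ) 1 = 1 := by simp [gnsVec, hf'.map_one]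
  rw [mul_one, h3, mul_one, gnsVec, ContinuousLinearMap.coe_coe, h2, Complex.ofReal_re,
    Real.sqrt_sq (norm_nonneg _)] at h1
  rwa [one_mul]

end TensorTools

/-! ### Conditional expectations -/

section ConditionalExpectation

variable {A : Type*} [CStarAlgebra A] {B : StarSubalgebra ℂ A} [IsClosed (B : Set A)]
  {P : A →ₗ[ℂ] B}

/-- Conditional expectations are completely positive: the quadratic forms of the matrix
`P (aᵢ* aⱼ)` are `P (y* y)` with `y = ∑ aᵢ dᵢ`, by the bimodule property. -/
theorem IsConditionalExpectation.isUCP (hP : IsConditionalExpectation P) : IsUCP P := by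
  refine ⟨hP.apply_coe 1, fun n a => isPSD_of_forall (fun i j => ?_) fun d => ?_⟩
  · rw [← hP.positive.map_star, star_mul, star_star]
  · have h1 : ∑ i, ∑ j, star (d i) * P (star (a i) * a j) * d j =
        P (star (∑ i, a i * (d i : A)) * ∑ i, a i * (d i : A)) := by
      simp only [star_sum, Finset.sum_mul_sum, map_sum]
      refine Finset.sum_congr rfl fun i _ => Finset.sum_congr rfl fun j _ => ?_
      rw [← hP.bimodule]
      congr 1
      simp [mul_assoc]
    rw [h1]
    let _ := CStarAlgebra.spectralOrder A
    let _ := CStarAlgebra.spectralOrder B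
    let _ := CStarAlgebra.spectralOrderedRing A
    let _ := CStarAlgebra.spectralOrderedRing B
    exact nonneg_iff_exists_star_mul_self.1 (hP.positive _ (star_mul_self_nonneg _))

end ConditionalExpectation

/-! ### Hypergroup structures on the image of a conditional expectation -/

section Restriction

variable {A : Type*} [CStarAlgebra A] {k : CStarTensorKind} {Δ : A →ₗ[ℂ] CStarTensor k A A}
  {ε : A →ₗ[ℂ] ℂ} {inv : A →ₗ⋆[ℂ] A} {B : StarSubalgebra ℂ A} [IsClosed (B : Set A)]
  {P : A →ₗ[ℂ] B}

/-- The hypergroup structure on the image of a conditional expectation `P`. The map `Q` is `P ⊗ P`,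
and `ΔB ∘ P = (P ⊗ P) ∘ Δ` expresses that the kernel of `P` is a coideal. -/
theorem IsHypergroupStructure.restrict (hA : IsHypergroupStructure Δ ε inv) (hΔ : IsUCP Δ)
    (hP : IsConditionalExpectation P) {Q : CStarTensor k A A →L[ℂ] CStarTensor k B B}
    (hQ : ∀ a b, Q (tmul k a b) = tmul k (P a) (P b))
    (hQu : IsUCP (Q : CStarTensor k A A →ₗ[ℂ] CStarTensor k B B))
    {ΔB : B →ₗ[ℂ] CStarTensor k B B} {εB : B →ₗ[ℂ] ℂ} {invB : B →ₗ⋆[ℂ] B}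
    (hΔB : ∀ b : B, ΔB b = Q (Δ b)) (hεB : ∀ b : B, εB b = ε b)
    (hinvB : ∀ b : B, (invB b : A) = inv b)
    (hco : ∀ a, Q (Δ a) = ΔB (P a)) (hPinv : ∀ a, P (inv a) = invB (P a))
    (hleft : ∀ b, tlift (fun x y => εB x • y) (ΔB b) = b)
    (hright : ∀ b, tlift (fun x y => εB y • x) (ΔB b) = b) :
    IsHypergroupStructure ΔB εB invB := by
  have hPu := hP.isUCP
  have hι : IsUCP (B.subtype : B →⋆ₐ[ℂ] A).toAlgHom.toLinearMap := IsUCP.of_starHom B.subtype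
  have hΔBu : IsUCP ΔB := by
    have h : ΔB = (Q : CStarTensor k A A →ₗ[ℂ] CStarTensor k B B) ∘ₗ Δ ∘ₗ
        (B.subtype : B →⋆ₐ[ℂ] A).toAlgHom.toLinearMap := LinearMap.ext hΔB
    rw [h]
    exact hQu.comp (hΔ.comp hι)
  have hinv_inv : ∀ b, invB (invB b) = b := fun b => Subtype.ext (by
    rw [hinvB, hinvB, hA.inv_inv])
  have hinv_mul : ∀ a b, invB (a * b) = invB a * invB b := fun a b => Subtype.ext (by
    rw [hinvB, MulMemClass.coe_mul, MulMemClass.coe_mul, hinvB, hinvB, hA.inv_mul])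
  have hinv_star : ∀ a, invB (star a) = star (invB a) := fun a => Subtype.ext (by
    rw [hinvB, StarMemClass.coe_star, StarMemClass.coe_star, hinvB, hA.inv_star])
  obtain ⟨LA, (hLA : ∀ a b, LA (tmul k a b) = tmul k (Δ a) b), -⟩ :=
    exists_tensorMap (k := k) hΔ (isUCP_id (A := A))
  obtain ⟨RA, (hRA : ∀ a b, RA (tmul k a b) = tmul k a (Δ b)), -⟩ :=
    exists_tensorMap (k := k) (isUCP_id (A := A)) hΔ
  obtain ⟨LB, (hLB : ∀ a b, LB (tmul k a b) = tmul k (ΔB a) b), -⟩ :=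
    exists_tensorMap (k := k) hΔBu (isUCP_id (A := B))
  obtain ⟨RB, (hRB : ∀ a b, RB (tmul k a b) = tmul k a (ΔB b)), -⟩ :=
    exists_tensorMap (k := k) (isUCP_id (A := B)) hΔBu
  refine
    { separable := ?_
      comul_id := ⟨LB, isTensorExtension_of_clm LB hLB⟩
      id_comul := ⟨RB, isTensorExtension_of_clm RB hRB⟩
      coassoc := fun b => ?_
      counit_left := hleft
      counit_right := hright
      comul_inv := fun b => ?_
      inv_inv := hinv_inv
      comul_positive := hΔBu.isPositiveMap
      inv_mul := hinv_mul
      comul_star := hΔBu.isPositiveMap.map_star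
      counit_mul := fun a b => by simp only [hεB, MulMemClass.coe_mul, hA.counit_mul]
      comul_one := hΔBu.map_one.trans tmul_one_one.symm
      inv_star := hinv_star }
  · have := hA.separable
    have : SecondCountableTopology A := UniformSpace.secondCountable_of_separable A
    have : SecondCountableTopology B := TopologicalSpace.Subtype.secondCountableTopology _
    exact TopologicalSpace.SecondCountableTopology.to_separableSpace
  · obtain ⟨αA, hαA⟩ := exists_assoc (k := k) (A := A) (B := A) (C := A)
    obtain ⟨αB, hαB⟩ := exists_assoc (k := k) (A := B) (B := B) (C := B)
    obtain ⟨QP, hQP, -⟩ := exists_tensorMap (k := k) hQu hPu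
    obtain ⟨PQ, hPQ, -⟩ := exists_tensorMap (k := k) hPu hQu
    have h1 : ∀ X, LB (Q X) = QP (LA X) := CStarTensor.hom_ext_apply (F := LB.comp Q)
      (F' := QP.comp LA) fun a b => by simp [hLB, hQ, hQP, hLA, hco]
    have h2 : ∀ X, RB (Q X) = PQ (RA X) := CStarTensor.hom_ext_apply (F := RB.comp Q)
      (F' := PQ.comp RA) fun a b => by simp [hRB, hQ, hPQ, hRA, hco]
    have h3 : ∀ X, αB (QP X) = PQ (αA X) := CStarTensor.hom_ext_apply₃ (F := αB.comp QP)
      (F' := PQ.comp αA) fun a b c => by simp [hαB, hQ, hPQ, hQP, hαA]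
    have hcoA := hA.coassoc (b : A)
    rw [tlift_eq_clm LA hLA, tlift_eq_clm RA hRA, tensorAssoc_eq_clm hαA] at hcoA
    rw [tlift_eq_clm LB hLB, tlift_eq_clm RB hRB, tensorAssoc_eq_clm hαB, hΔB, h1, h2, h3, hcoA]
  · obtain ⟨cA, hcA⟩ := exists_conjTensor (k := k) inv hA.inv_inv hA.inv_mul hA.inv_star
    obtain ⟨cB, hcB⟩ := exists_conjTensor (k := k) invB hinv_inv hinv_mul hinv_star
    obtain ⟨SA, hSA⟩ := exists_flip (k := k) (A := A) (B := A)
    obtain ⟨SB, hSB⟩ := exists_flip (k := k) (A := B) (B := B)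
    have h1 : ∀ X, Q (cA X) = cB (Q X) := CStarTensor.hom_ext_apply (F := Q.comp cA)
      (F' := cB.comp Q) fun a b => by simp [hcA, hcB, hQ, hPinv]
    have h2 : ∀ X, Q (SA X) = SB (Q X) := CStarTensor.hom_ext_apply (F := Q.comp SA)
      (F' := SB.comp Q) fun a b => by simp [hSA, hSB, hQ]
    rw [tlift_eq_clm cB hcB, tensorFlip_eq_clm hSB, hΔB, hΔB, hinvB, hA.comul_inv,
      tlift_eq_clm cA hcA, tensorFlip_eq_clm hSA, h2, h1]

/-- Conditional expectations map positive definite elements to positive definite elements: a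
functional `ξ` on `B` is tested by `ξ ∘ P` on `A`. -/
theorem IsPositiveDefinite.map {a : A} (ha : IsPositiveDefinite Δ inv a) (hPc : Continuous P)
    {Q : CStarTensor k A A →L[ℂ] CStarTensor k B B}
    (hQ : ∀ a b, Q (tmul k a b) = tmul k (P a) (P b))
    {ΔB : B →ₗ[ℂ] CStarTensor k B B} {invB : B →ₗ⋆[ℂ] B} (hinvc : Continuous invB)
    (hco : ∀ a, Q (Δ a) = ΔB (P a)) (hPinv : ∀ a, P (inv a) = invB (P a)) :
    IsPositiveDefinite ΔB invB (P a) := by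
  intro ξ
  let ξ' : B →L[ℂ] ℂ := ⟨conjComp (ξ : B →ₗ[ℂ] ℂ) invB,
    Complex.continuous_conj.comp (ξ.continuous.comp hinvc)⟩
  obtain ⟨F, hF⟩ := exists_prod_functional (k := k) ξ ξ'
  have h1 := ha (ξ.comp ⟨P, hPc⟩)
  rw [tlift_eq_clm (F.comp Q)] at h1
  · have h2 : tlift (fun x y => ξ x * conj (ξ (invB y))) = F := tlift_eq_clm F hF
    rw [h2, ← hco]
    exact h1
  · intro x y
    change F (Q (tmul k x y)) = ξ (P x) * conj (ξ (P (inv y)))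
    rw [hQ, hF, hPinv]
    rfl

theorem IsHaarMeasure.restrict {μ : A →L[ℂ] ℂ} (hμ : IsHaarMeasure Δ μ) (hPc : Continuous P)
    (hPμ : ∀ a, μ (P a : A) = μ a) {Q : CStarTensor k A A →L[ℂ] CStarTensor k B B}
    (hQ : ∀ a b, Q (tmul k a b) = tmul k (P a) (P b)) (hP1 : P 1 = 1)
    {ΔB : B →ₗ[ℂ] CStarTensor k B B} {μB : B →L[ℂ] ℂ} (hΔB : ∀ b : B, ΔB b = Q (Δ b))
    (hμB : ∀ b : B, μB b = μ b) : IsHaarMeasure ΔB μB := by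
  obtain ⟨LA, hLA⟩ := exists_slice_left (k := k) (B := A) μ
  obtain ⟨RA, hRA⟩ := exists_slice_right (k := k) (A := A) μ
  obtain ⟨LB, hLB⟩ := exists_slice_left (k := k) (B := B) μB
  obtain ⟨RB, hRB⟩ := exists_slice_right (k := k) (A := B) μB
  have h1 : ∀ X, LB (Q X) = P (LA X) := CStarTensor.hom_ext_apply (F := LB.comp Q)
    (F' := (⟨P, hPc⟩ : A →L[ℂ] B).comp LA) fun a b => by
      change LB (Q (tmul k a b)) = P (LA (tmul k a b))
      rw [hQ, hLB, hLA, hμB, hPμ, map_smul]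
  have h2 : ∀ X, RB (Q X) = P (RA X) := CStarTensor.hom_ext_apply (F := RB.comp Q)
    (F' := (⟨P, hPc⟩ : A →L[ℂ] B).comp RA) fun a b => by
      change RB (Q (tmul k a b)) = P (RA (tmul k a b))
      rw [hQ, hRB, hRA, hμB, hPμ, map_smul]
  refine ⟨⟨fun b => ?_, ?_⟩, fun b => ?_, fun b => ?_⟩
  · rw [hμB]
    exact hμ.isState.nonneg (b : A)
  · rw [hμB]
    exact hμ.isState.map_one
  · have := hμ.left_inv (b : A)
    rw [tlift_eq_clm LA hLA] at this
    rw [tlift_eq_clm LB hLB, hΔB, h1, this, map_smul, hP1, hμB]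
  · have := hμ.right_inv (b : A)
    rw [tlift_eq_clm RA hRA] at this
    rw [tlift_eq_clm RB hRB, hΔB, h2, this, map_smul, hP1, hμB]

end Restriction

end QHyp

/-! ### The quotient hypergroup -/

theorem theorem2p1 {A : Type*} [CStarAlgebra A] (k : CStarTensorKind)
    (Δ : A →ₗ[ℂ] CStarTensor k A A) (ε : A →ₗ[ℂ] ℂ) (inv : A →ₗ⋆[ℂ] A) (σ : ℝ → A ≃⋆ₐ[ℂ] A)
    (μ : A →L[ℂ] ℂ) (A₀ : Subalgebra ℂ A) (A₂ : Subalgebra ℂ (CStarTensor k A A))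
    (σc : ℂ → A₀ ≃ₐ[ℂ] A₀)
    (hA : IsCompactQuantumHypergroupOn Δ ε inv σ μ A₀ A₂ σc)
    (B : StarSubalgebra ℂ A) [IsClosed (B : Set A)] (P : A →ₗ[ℂ] B)
    (hP : IsConditionalExpectation P) (hμ : ∀ a : A, μ (P a : A) = μ a)
    (h_coideal : ∀ x : A, tlift (fun a b => tmul k (P a) (P b)) (Δ x) =
      tlift (fun a b => tmul k (P a) (P b)) (Δ (P x : A)))
    (h_inv : ∀ a : A, ((P (inv a) : B) : A) = inv (P a : A))
    (h_A₀ : ∀ a ∈ A₀, (P a : A) ∈ A₀)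
    (h_A₂ : ∀ x ∈ A₂, tlift (fun a b => tmul k (P a : A) (P b : A)) x ∈ A₂)
    (h_σ : ∀ (z : ℂ) (a : A₀),
      ((P (σc z a : A) : B) : A) = (σc z ⟨(P (a : A) : A), h_A₀ a a.2⟩ : A))
    (h_counit_left : ∀ b : B, tlift (fun (x y : B) => ε (x : A) • y)
      (tlift (fun a c => tmul k (P a) (P c)) (Δ (b : A))) = b)
    (h_counit_right : ∀ b : B, tlift (fun (x y : B) => ε (y : A) • x)
      (tlift (fun a c => tmul k (P a) (P c)) (Δ (b : A))) = b) :
    ∃ (ΔB : B →ₗ[ℂ] CStarTensor k B B) (εB : B →ₗ[ℂ] ℂ) (invB : B →ₗ⋆[ℂ] B)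
      (σB : ℝ → B ≃⋆ₐ[ℂ] B) (μB : B →L[ℂ] ℂ),
      (∀ b : B, ΔB b = tlift (fun a c => tmul k (P a) (P c)) (Δ (b : A))) ∧
      (∀ b : B, εB b = ε b) ∧
      (∀ b : B, (invB b : A) = inv b) ∧
      (∀ (t : ℝ) (b : B), (σB t b : A) = σ t b) ∧
      (∀ b : B, μB b = μ b) ∧
      IsCompactQuantumHypergroup ΔB εB invB σB μB := by
  have hH := hA.hypergroup
  have hPu := hP.isUCP
  have hPc : Continuous P := hP.positive.continuous
  have hPP : ∀ b : B, P (b : A) = b := hP.apply_coe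
  have hΔ : IsUCP Δ := hA.completelyPositive.isUCP (hH.comul_one.trans tmul_one_one)
  -- the tensor products of `P` and of the inclusion, and the projection `J ∘ Q` of `A ⊗ A`
  obtain ⟨Q, hQ, hQu⟩ := exists_tensorMap (k := k) hPu hPu
  obtain ⟨J, hJc, hJ⟩ := exists_tensorHom (k := k) B.subtype B.subtype
  let JL : CStarTensor k B B →L[ℂ] CStarTensor k A A := ⟨J.toAlgHom.toLinearMap, hJc⟩
  have hJL : ∀ y, JL y = J y := fun y => rfl
  have hQJ : ∀ y, Q (J y) = y := CStarTensor.hom_ext_apply (F := Q.comp JL)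
    (F' := ContinuousLinearMap.id ℂ _) fun a b => by simp [hJL, hJ, hQ, hPP]
  have htQ : (tlift fun a b => tmul k (P a) (P b)) = Q := tlift_eq_clm Q hQ
  have htJQ : (tlift fun a b => tmul k (P a : A) (P b : A)) = JL.comp Q :=
    tlift_eq_clm _ fun a b => by simp [hJL, hJ, hQ]
  simp only [htQ, htJQ] at *
  -- restrictions of the structure maps
  have hinvB : ∀ b : B, inv (b : A) ∈ B := fun b => by
    have := h_inv (b : A)
    rw [hPP] at this
    exact this ▸ (P (inv (b : A))).2
  have hσc : ∀ t, Continuous (σ t) := fun t =>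
    (IsUCP.of_starHom (σ t : A →⋆ₐ[ℂ] A)).isPositiveMap.continuous
  -- by hypothesis `P` commutes with `σ` on `A₀` only; this extends to `A` by density
  have hPσ : ∀ t a, (P (σ t a) : A) = σ t (P a : A) := by
    intro t
    refine fun a => congrFun (Continuous.ext_on hA.dense_A₀
      (continuous_subtype_val.comp (hPc.comp (hσc t)))
      ((hσc t).comp (continuous_subtype_val.comp hPc)) fun a ha => ?_) a
    have := h_σ t ⟨a, ha⟩
    rw [hA.extends_σ.map_real, hA.extends_σ.map_real] at this
    exact this
  have hσ0 : ∀ a, σ 0 a = a := fun a => by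
    have := hA.σ_add 0 0 a
    rw [add_zero] at this
    exact ((σ 0).injective this).symm
  have hσB : ∀ t (b : B), σ t (b : A) ∈ B := fun t b => by
    have := hPσ t (b : A)
    rw [hPP] at this
    exact this ▸ (P (σ t (b : A))).2
  let ΔB : B →ₗ[ℂ] CStarTensor k B B := (Q : CStarTensor k A A →ₗ[ℂ] CStarTensor k B B) ∘ₗ Δ ∘ₗ
    (B.subtype : B →⋆ₐ[ℂ] A).toAlgHom.toLinearMap
  let εB : B →ₗ[ℂ] ℂ := ε ∘ₗ (B.subtype : B →⋆ₐ[ℂ] A).toAlgHom.toLinearMap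
  let invB : B →ₗ⋆[ℂ] B :=
    { toFun := fun b => ⟨inv (b : A), hinvB b⟩
      map_add' := fun a b => Subtype.ext (map_add inv _ _)
      map_smul' := fun c a => Subtype.ext (inv.map_smulₛₗ c (a : A)) }
  let s : ℝ → B →⋆ₐ[ℂ] B := fun t => ((σ t : A →⋆ₐ[ℂ] A).comp B.subtype).codRestrict B (hσB t)
  have hs : ∀ t (b : B), (s t b : A) = σ t b := fun t b => rfl
  let σB : ℝ → B ≃⋆ₐ[ℂ] B := fun t => StarAlgEquiv.ofStarAlgHom (s t) (s (-t))
    (by ext b; simp only [StarAlgHom.comp_apply, hs, ← hA.σ_add, neg_add_cancel, hσ0]; rfl)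
    (by ext b; simp only [StarAlgHom.comp_apply, hs, ← hA.σ_add, add_neg_cancel, hσ0]; rfl)
  have hσBs : ∀ t (b : B), (σB t b : A) = σ t b := fun t b => rfl
  let μB : B →L[ℂ] ℂ := ⟨(μ : A →ₗ[ℂ] ℂ) ∘ₗ (B.subtype : B →⋆ₐ[ℂ] A).toAlgHom.toLinearMap,
    μ.continuous.comp continuous_subtype_val⟩
  have hPinv : ∀ a, P (inv a) = invB (P a) := fun a => Subtype.ext (h_inv a)
  have hco : ∀ a, Q (Δ a) = ΔB (P a) := h_coideal
  have hHB : IsHypergroupStructure ΔB εB invB := hH.restrict hΔ hP hQ hQu (fun _ => rfl)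
    (fun _ => rfl) (fun _ => rfl) hco hPinv h_counit_left h_counit_right
  have hΔBu : IsUCP ΔB := hQu.comp (hΔ.comp (IsUCP.of_starHom B.subtype))
  refine ⟨ΔB, εB, invB, σB, μB, fun _ => rfl, fun _ => rfl, fun _ => rfl, hσBs, fun _ => rfl, ?_⟩
  -- the complex one-parameter groups on `B` and `B ⊗ B`
  let ι : B →ₐ[ℂ] A := (B.subtype : B →⋆ₐ[ℂ] A).toAlgHom
  let PL : A →L[ℂ] B := ⟨P, hPc⟩
  have hιc : Continuous ι := continuous_subtype_val
  obtain ⟨σcB, hσcB, hσcBι⟩ := hA.extends_σ.exists_restrict (j := ι) hιc (Q := PL) hPP h_A₀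
    (fun t a _ => hPσ t a) (τ' := fun t => σB t) hσBs
  obtain ⟨σl, σr, hσl, hσr, hσΔ⟩ := hA.extends_σ₂
  choose Sl hSlc hSl using fun t => exists_tensorHom (k := k) (σ t : A →⋆ₐ[ℂ] A)
    (StarAlgHom.id ℂ A)
  choose Sr hSrc hSr using fun t => exists_tensorHom (k := k) (StarAlgHom.id ℂ A)
    (σ t : A →⋆ₐ[ℂ] A)
  choose SlB hSlBc hSlB using fun t => exists_tensorHom (k := k) (σB t : B →⋆ₐ[ℂ] B)
    (StarAlgHom.id ℂ B)
  choose SrB hSrBc hSrB using fun t => exists_tensorHom (k := k) (StarAlgHom.id ℂ B)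
    (σB t : B →⋆ₐ[ℂ] B)
  let SlL : ℝ → CStarTensor k A A →L[ℂ] CStarTensor k A A := fun t =>
    ⟨(Sl t).toAlgHom.toLinearMap, hSlc t⟩
  let SrL : ℝ → CStarTensor k A A →L[ℂ] CStarTensor k A A := fun t =>
    ⟨(Sr t).toAlgHom.toLinearMap, hSrc t⟩
  let SlBL : ℝ → CStarTensor k B B →L[ℂ] CStarTensor k B B := fun t =>
    ⟨(SlB t).toAlgHom.toLinearMap, hSlBc t⟩
  let SrBL : ℝ → CStarTensor k B B →L[ℂ] CStarTensor k B B := fun t =>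
    ⟨(SrB t).toAlgHom.toLinearMap, hSrBc t⟩
  have hSlL : ∀ t x y, SlL t (tmul k x y) = tmul k (σ t x) y := hSl
  have hSrL : ∀ t x y, SrL t (tmul k x y) = tmul k x (σ t y) := hSr
  have hSlBL : ∀ t x y, SlBL t (tmul k x y) = tmul k (σB t x) y := hSlB
  have hSrBL : ∀ t x y, SrBL t (tmul k x y) = tmul k x (σB t y) := hSrB
  have htl : (fun t : ℝ => tlift fun x y => tmul k (σ t x) y) = fun t => ⇑(SlL t) :=
    funext fun t => tlift_eq_clm _ (hSlL t)
  have htr : (fun t : ℝ => tlift fun x y => tmul k x (σ t y)) = fun t => ⇑(SrL t) :=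
    funext fun t => tlift_eq_clm _ (hSrL t)
  have htlB : (fun t : ℝ => tlift fun x y => tmul k (σB t x) y) = fun t => ⇑(SlBL t) :=
    funext fun t => tlift_eq_clm _ (hSlBL t)
  have htrB : (fun t : ℝ => tlift fun x y => tmul k x (σB t y)) = fun t => ⇑(SrBL t) :=
    funext fun t => tlift_eq_clm _ (hSrBL t)
  rw [htl] at hσl
  rw [htr] at hσr
  have hJL' : ∀ a b : B, JL (tmul k a b) = tmul k (a : A) (b : A) := hJ
  have hlJ : ∀ t y, JL (SlBL t y) = SlL t (JL y) := fun t => CStarTensor.hom_ext_apply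
    (F := JL.comp (SlBL t)) (F' := (SlL t).comp JL) fun a b => by
      simp only [ContinuousLinearMap.comp_apply, hSlBL, hJL', hSlL, hσBs]
  have hrJ : ∀ t y, JL (SrBL t y) = SrL t (JL y) := fun t => CStarTensor.hom_ext_apply
    (F := JL.comp (SrBL t)) (F' := (SrL t).comp JL) fun a b => by
      simp only [ContinuousLinearMap.comp_apply, hSrBL, hJL', hSrL, hσBs]
  have hlQ : ∀ t x, JL (Q (SlL t x)) = SlL t (JL (Q x)) := fun t => CStarTensor.hom_ext_apply
    (F := (JL.comp Q).comp (SlL t)) (F' := (SlL t).comp (JL.comp Q)) fun a b => by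
      simp only [ContinuousLinearMap.comp_apply, hSlL, hJL', hQ, hPσ]
  have hrQ : ∀ t x, JL (Q (SrL t x)) = SrL t (JL (Q x)) := fun t => CStarTensor.hom_ext_apply
    (F := (JL.comp Q).comp (SrL t)) (F' := (SrL t).comp (JL.comp Q)) fun a b => by
      simp only [ContinuousLinearMap.comp_apply, hSrL, hJL', hQ, hPσ]
  obtain ⟨σlB, hσlB, hσlBJ⟩ := hσl.exists_restrict (j := J.toAlgHom) hJc (Q := Q) hQJ h_A₂
    (fun t x _ => hlQ t x) (τ' := fun t => SlBL t) hlJ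
  obtain ⟨σrB, hσrB, hσrBJ⟩ := hσr.exists_restrict (j := J.toAlgHom) hJc (Q := Q) hQJ h_A₂
    (fun t x _ => hrQ t x) (τ' := fun t => SrBL t) hrJ
  have hlc := hσl.commute (JL.comp Q) h_A₂ fun t x _ => hlQ t x
  have hrc := hσr.commute (JL.comp Q) h_A₂ fun t x _ => hrQ t x
  have hinvBc : Continuous invB := continuous_of_conj invB hHB.inv_inv hHB.inv_mul hHB.inv_star
  have hcomul : ∀ a ∈ A₀.comap ι, ΔB a ∈ A₂.comap J.toAlgHom := fun a ha =>
    h_A₂ _ (hA.comul_mem _ ha)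
  -- right slices by the Haar measure intertwine `P ⊗ P` and `P`
  obtain ⟨RA, hRA⟩ := exists_slice_right (k := k) (A := A) μ
  obtain ⟨RB, hRB⟩ := exists_slice_right (k := k) (A := B) μB
  have htRA : (tlift fun x y => μ y • x) = RA := tlift_eq_clm RA hRA
  have htRB : (tlift fun x y => μB y • x) = RB := tlift_eq_clm RB hRB
  have hRQ : ∀ X, RB (Q X) = P (RA X) := CStarTensor.hom_ext_apply (F := RB.comp Q)
    (F' := PL.comp RA) fun a b => by
      change RB (Q (tmul k a b)) = P (RA (tmul k a b))
      rw [hQ, hRB, hRA, map_smul]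
      congr 1
      exact hμ b
  have hQl : ∀ (b : B) X, Q (tmul k 1 (b : A) * X) = tmul k 1 b * Q X := fun b =>
    CStarTensor.hom_ext_apply (F := Q.comp (ContinuousLinearMap.mul ℂ _ (tmul k 1 (b : A))))
      (F' := (ContinuousLinearMap.mul ℂ _ (tmul k 1 b)).comp Q) fun x y => by
      have := hP.bimodule b 1 y
      simp only [OneMemClass.coe_one, mul_one] at this
      simp [hQ, this]
  have hQr : ∀ (b : B) X, Q (X * tmul k 1 (b : A)) = Q X * tmul k 1 b := fun b =>
    CStarTensor.hom_ext_apply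
      (F := Q.comp ((ContinuousLinearMap.mul ℂ (CStarTensor k A A)).flip (tmul k 1 (b : A))))
      (F' := ((ContinuousLinearMap.mul ℂ (CStarTensor k B B)).flip (tmul k 1 b)).comp Q) fun x y => by
      have := hP.bimodule 1 b y
      simp only [OneMemClass.coe_one, one_mul] at this
      simp [hQ, this]
  refine ⟨A₀.comap ι, A₂.comap J.toAlgHom, σcB,
    { hypergroup := hHB
      haar := hA.haar.restrict hPc hμ hQ hPu.map_one (fun _ => rfl) fun _ => rfl
      completelyPositive := hΔBu.isCompletelyPositive
      dense_positiveDefinite := ?_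
      σ_add := fun s t b => Subtype.ext (hA.σ_add s t b)
      σ_continuous := fun b => (hA.σ_continuous (b : A)).subtype_mk _
      dense_A₀ := dense_comap (j := ι) (Q := PL) hA.dense_A₀ hPP h_A₀
      dense_A₂ := dense_comap (j := J.toAlgHom) hA.dense_A₂ hQJ h_A₂
      extends_σ := hσcB
      star_mem := fun a ha => hA.star_mem _ ha
      inv_mem := fun a ha => hA.inv_mem _ ha
      comul_mem := hcomul
      extends_σ₂ := ⟨σlB, σrB, htlB ▸ hσlB, htrB ▸ hσrB, fun z a => ?_⟩
      haar_σ := fun z a => ?_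
      strong_invariance := ?_
      faithful := fun a ha h => Subtype.ext (hA.faithful a ha h) }⟩
  · have hs : Function.Surjective PL := fun b => ⟨b, hPP b⟩
    refine (hs.denseRange.dense_image PL.continuous hA.dense_positiveDefinite).mono ?_
    rintro _ ⟨x, hx, rfl⟩
    refine (Submodule.map_span_le P _ (Submodule.span ℂ _)).2 (fun a ha => ?_)
      (Submodule.mem_map_of_mem hx)
    exact Submodule.subset_span (IsPositiveDefinite.map ha hPc hQ hinvBc hco hPinv)
  -- `Δ σ_z = (σ_z ⊗ σ_z) Δ` on `B` is checked in `A ⊗ A`, where `(ι ⊗ ι) ΔB` is `(ι P ⊗ ι P) Δ`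
  · refine Function.LeftInverse.injective hQJ ?_
    have e1 : J (ΔB (σcB z a)) = (JL.comp Q) (Δ (σc z ⟨ι a, a.2⟩)) := by
      rw [← hσcBι]
      rfl
    refine e1.trans (Eq.trans ?_ (hσlBJ z _).symm)
    rw [hσΔ, hlc]
    congr 2
    exact Subtype.ext ((hrc z _).trans (hσrBJ z ⟨ΔB a, hcomul a a.2⟩).symm)
  · change μ (ι (σcB z a)) = μ (ι a)
    rw [hσcBι, hA.haar_σ]
  · obtain ⟨z₀, h⟩ := hA.strong_invariance
    refine ⟨z₀, fun a ha b hb => ?_⟩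
    obtain ⟨f, hf, hft, hfz⟩ := h _ ha _ hb
    rw [htRA] at hft hfz
    rw [htRB]
    -- `P` maps the entire extension of `t ↦ σ_t (s^⋆)` to the one for the slice `P s` in `B`
    refine ⟨fun z => P (f z), PL.differentiable.comp hf, fun t => Subtype.ext ?_, ?_⟩
    · change (P (f t) : A) = σ t (inv (RB (Q (Δ (a : A)) * tmul k 1 b) : B))
      rw [hft, hPσ, h_inv, ← hQr, hRQ]
      rfl
    · change star (P (f z₀)) = RB (tmul k 1 a * Q (Δ (b : A)))
      rw [← hP.positive.map_star, hfz, ← hQl, hRQ]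
      rfl
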